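/- **Machine model.** Algorithms are deterministic word-RAM programs with words of $\mathcal O(\log N)$ bits, where $N$ is the input size (length of the input in words plus number of variables $n$). The machine also has unit-cost dictionaries: it can initialize a dictionary with a default value, and read or write the value stored under the key that is written in a special query array. Running time is the number of elementary operations. **Problems.** For $k\in\mathbb N$, $k$-SAT asks whether a given $k$-CNF formula (a set of clauses of at most $k$ literals each, in $n$ Boolean variables) is satisfiable. The *Strong Exponential Time Hypothesis* (SETH) states: for every $\varepsilon>0$ there is some $k\ge 3$ such that $k$-SAT cannot be solved in time $\mathcal O(2^{(1-\varepsilon)n})$. For a prime power $q$ and a positive integer $d$, the problem $\mathrm{PES}_{q,d}$ asks, given polynomials $P_1,\dots,P_m\in\mathbb F_q[X_1,\dots,X_n]$ of total degree at most $d$, each given as an explicit list of its monomials with their non-zero coefficients, whether there is $x\in\mathbb F_q^n$ with $P_1(x)=\dots=P_m(x)=0$. The notation $\mathcal O^*(\cdot)$ hides factors polynomial in the input size $N$. **Theorem.** If SETH holds, then for all prime powers $q$ and all rationals $\delta>0$ there exists a positive integer $d$ such that there is no $\mathcal O^*\big(q^{(1-\delta)n}\big)$-time algorithm for $\mathrm{PES}_{q,d}$.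 -/

import Mathlib

/-! ## The machine model: a word-RAM with dictionaries -/

namespace WordRAM

/-- Binary operations on words. Comparisons return `1` for true and `0` for false, subtraction is
truncated, and division by zero returns `0`. -/
inductive BinOp
  | add | sub | mul | div | mod | land | lor | xor | shl | shr | eq | lt

/-- The value of a binary operation, before the check that it fits into a word. -/
def BinOp.apply : BinOp → ℕ → ℕ → ℕ
  | .add, a, b => a + b
  | .sub, a, b => a - b
  | .mul, a, b => a * b
  | .div, a, b => a / b
  | .mod, a, b => a % b
  | .land, a, b => a &&& b
  | .lor, a, b => a ||| b
  | .xor, a, b => a ^^^ b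
  | .shl, a, b => a <<< b
  | .shr, a, b => a >>> b
  | .eq, a, b => if a = b then 1 else 0
  | .lt, a, b => if a < b then 1 else 0

/-- A memory state: registers, arrays of words (array number, then position), and dictionaries
(dictionary number, then key; a key is a finite sequence of words). -/
@[ext]
structure State where
  reg : ℕ → ℕ
  arr : ℕ → ℕ → ℕ
  dict : ℕ → List ℕ → ℕ

/-- Programs. Operands `x y z i h l v` are names of registers and `a` is the name of an array; a
program mentions only finitely many of them. Dictionaries are referred to by a word (the content
of the register `h`). The key of a dictionary access is the content of the first `l` cells of the
query array, which is array number `1`. -/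
inductive Prog
  /-- do nothing -/
  | skip
  /-- `x := c` -/
  | const (x c : ℕ)
  /-- `x := y o z` -/
  | op (x : ℕ) (o : BinOp) (y z : ℕ)
  /-- `x := a[i]` -/
  | load (x a i : ℕ)
  /-- `a[i] := x` -/
  | store (a i x : ℕ)
  /-- make `h` a new dictionary, all of whose keys have the default value `v` -/
  | dictNew (h v : ℕ)
  /-- `x :=` the value of the dictionary `h` at the key in the query array -/
  | dictRead (x h l : ℕ)
  /-- set the value of the dictionary `h` at the key in the query array to `v` -/
  | dictWrite (h l v : ℕ)
  /-- `p; p'` -/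
  | seq (p p' : Prog)
  /-- `if x ≠ 0 then p else p'` -/
  | cond (x : ℕ) (p p' : Prog)
  /-- `while x ≠ 0 do p` -/
  | loop (x : ℕ) (p : Prog)

namespace State

/-- Write the word `v` into the register `x`. -/
def setReg (s : State) (x v : ℕ) : State :=
  { s with reg := Function.update s.reg x v }

/-- Write the word `v` into the cell `i` of the array `a`. -/
def setArr (s : State) (a i v : ℕ) : State :=
  { s with arr := Function.update s.arr a (Function.update (s.arr a) i v) }

/-- Replace the dictionary number `h` by `D`. -/
def setDict (s : State) (h : ℕ) (D : List ℕ → ℕ) : State :=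
  { s with dict := Function.update s.dict h D }

/-- The key of length `len` that is written in the query array. -/
def key (s : State) (len : ℕ) : List ℕ :=
  (List.range len).map (s.arr 1)

/-- The initial state on the input `xs`: array `0` holds `xs`, register `0` holds its length, and
everything else is `0`. -/
def initial (xs : List ℕ) : State where
  reg x := if x = 0 then xs.length else 0
  arr a i := if a = 0 then xs.getD i 0 else 0
  dict _ _ := 0

end State

/-- `Exec W p s t s'`: on a machine whose words hold the numbers below `W`, the program `p`,
started in the state `s`, halts in the state `s'` after `t` elementary operations. Every
assignment, memory or dictionary access, and test counts as one operation. A program that produces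
a number that does not fit into a word gets stuck, and then it has no execution. -/
inductive Exec (W : ℕ) : Prog → State → ℕ → State → Prop
  | skip (s) : Exec W .skip s 1 s
  | const (x c s) (hc : c < W) : Exec W (.const x c) s 1 (s.setReg x c)
  | op (x o y z s) (hw : BinOp.apply o (s.reg y) (s.reg z) < W) :
      Exec W (.op x o y z) s 1 (s.setReg x (BinOp.apply o (s.reg y) (s.reg z)))
  | load (x a i s) (hw : s.arr a (s.reg i) < W) :
      Exec W (.load x a i) s 1 (s.setReg x (s.arr a (s.reg i)))
  | store (a i x s) (hw : s.reg x < W) :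
      Exec W (.store a i x) s 1 (s.setArr a (s.reg i) (s.reg x))
  | dictNew (h v s) (hw : s.reg v < W) :
      Exec W (.dictNew h v) s 1 (s.setDict (s.reg h) (fun _ => s.reg v))
  | dictRead (x h l s) (hw : s.dict (s.reg h) (s.key (s.reg l)) < W) :
      Exec W (.dictRead x h l) s 1 (s.setReg x (s.dict (s.reg h) (s.key (s.reg l))))
  | dictWrite (h l v s) (hw : s.reg v < W) :
      Exec W (.dictWrite h l v) s 1
        (s.setDict (s.reg h)
          (Function.update (s.dict (s.reg h)) (s.key (s.reg l)) (s.reg v)))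
  | seq {p p' s t s' t' s''} (h : Exec W p s t s') (h' : Exec W p' s' t' s'') :
      Exec W (.seq p p') s (t + t') s''
  | condTrue {x p p' s t s'} (hx : s.reg x ≠ 0) (h : Exec W p s t s') :
      Exec W (.cond x p p') s (t + 1) s'
  | condFalse {x p p' s t s'} (hx : s.reg x = 0) (h : Exec W p' s t s') :
      Exec W (.cond x p p') s (t + 1) s'
  | loopTrue {x p s t s' t' s''} (hx : s.reg x ≠ 0) (h : Exec W p s t s')
      (h' : Exec W (.loop x p) s' t' s'') : Exec W (.loop x p) s (t + t' + 1) s''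
  | loopFalse {x p s} (hx : s.reg x = 0) : Exec W (.loop x p) s 1 s

end WordRAM

/-! ## Decision problems and running times -/

/-- A decision problem with a parameter `n` (the number of variables). -/
structure DecisionProblem where
  /-- the instances -/
  Inst : Type
  /-- the number of variables of an instance -/
  numVars : Inst → ℕ
  /-- the encoding of an instance by a sequence of words -/
  encode : Inst → List ℕ
  /-- the yes-instances -/
  Yes : Inst → Prop

namespace DecisionProblem

/-- The input size: the length of the encoding plus the number of variables. -/
def size (P : DecisionProblem) (I : P.Inst) : ℕ :=
  P.numVars I + (P.encode I).length

/-- `P.SolvableInTime T`: there is a (deterministic) word-RAM program that decides `P`, uses words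
of `O(log N)` bits on instances of size `N` (words hold the numbers below `(N + 2) ^ c`), and halts
on every instance `I` after at most `T I` operations. The answer `yes` is given by leaving the
number `1` in register `0`. -/
def SolvableInTime (P : DecisionProblem) (T : P.Inst → ℝ) : Prop :=
  ∃ (p : WordRAM.Prog) (c : ℕ), ∀ I : P.Inst, ∃ (t : ℕ) (s : WordRAM.State),
    WordRAM.Exec ((P.size I + 2) ^ c) p (WordRAM.State.initial (P.encode I)) t s ∧
      (t : ℝ) ≤ T I ∧ (s.reg 0 = 1 ↔ P.Yes I)

/-- `P` can be solved in time `O(f n)`. -/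
def SolvableInBigO (P : DecisionProblem) (f : ℕ → ℝ) : Prop :=
  ∃ C : ℝ, P.SolvableInTime fun I => C * f (P.numVars I)

/-- `P` can be solved in time `O*(f n)`, where factors polynomial in the input size are hidden. -/
def SolvableInOStar (P : DecisionProblem) (f : ℕ → ℝ) : Prop :=
  ∃ c : ℕ, P.SolvableInTime fun I => (c : ℝ) * ((P.size I : ℝ) + 1) ^ c * f (P.numVars I)

end DecisionProblem

/-! ## `k`-SAT and the Strong Exponential Time Hypothesis -/

/-- A `k`-CNF formula in the variables `x_0, …, x_{n-1}`: a list of distinct clauses of at most `k`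
literals. The literal `(v, true)` is `x_v`, and `(v, false)` is its negation. -/
structure KCNF (k : ℕ) where
  n : ℕ
  clauses : List (List (Fin n × Bool))
  nodup : clauses.Nodup
  width : ∀ C ∈ clauses, C.length ≤ k

namespace KCNF

variable {k : ℕ}

/-- Some assignment makes at least one literal of every clause true. -/
def Satisfiable (φ : KCNF k) : Prop :=
  ∃ x : Fin φ.n → Bool, ∀ C ∈ φ.clauses, ∃ l ∈ C, x l.1 = l.2

/-- A clause is encoded by its length followed by its literals. -/
def encodeClause {n : ℕ} (C : List (Fin n × Bool)) : List ℕ :=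
  C.length :: C.map fun l => 2 * (l.1 : ℕ) + l.2.toNat

/-- A formula is encoded by the number of variables, the number of clauses, and the clauses. -/
def encode (φ : KCNF k) : List ℕ :=
  φ.n :: φ.clauses.length :: φ.clauses.flatMap encodeClause

end KCNF

/-- The problem `k`-SAT. -/
def kSAT (k : ℕ) : DecisionProblem where
  Inst := KCNF k
  numVars φ := φ.n
  encode φ := φ.encode
  Yes φ := φ.Satisfiable

/-- The Strong Exponential Time Hypothesis: for all `ε > 0` there is some `k ≥ 3` such that `k`-SAT
cannot be solved in time `O(2 ^ ((1 - ε) n))`. -/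
def SETH : Prop :=
  ∀ ε : ℝ, 0 < ε → ∃ k : ℕ, 3 ≤ k ∧
    ¬ (kSAT k).SolvableInBigO fun n => (2 : ℝ) ^ ((1 - ε) * (n : ℝ))

/-! ## Polynomial equation systems -/

/-- A polynomial of degree at most `d` in `n` variables over `F`, together with an enumeration
(in any order, without repetition) of the monomials with a non-zero coefficient. -/
structure ListedPoly (F : Type) [Field F] (n d : ℕ) where
  poly : MvPolynomial (Fin n) F
  degree_le : poly.totalDegree ≤ d
  monomials : List (Fin n →₀ ℕ)
  nodup : monomials.Nodup
  mem_monomials : ∀ M, M ∈ monomials ↔ M ∈ poly.support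

/-- A polynomial is encoded by the number of its monomials, followed by the list of its
monomial-coefficient pairs. Each pair consists of the coefficient and the `n` exponents. The
elements of `F` are represented by the numbers `0, …, q - 1` by means of `e`. -/
def ListedPoly.encode {F : Type} [Field F] {q : ℕ} (e : F ≃ Fin q) {n d : ℕ}
    (P : ListedPoly F n d) : List ℕ :=
  P.monomials.length ::
    P.monomials.flatMap fun M => ((e (P.poly.coeff M) : Fin q) : ℕ) :: List.ofFn fun i => M i

/-- An instance of the problem: a list of polynomials of degree at most `d` in `n` variables. -/
structure PESInstance (F : Type) [Field F] (d : ℕ) where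
  n : ℕ
  polys : List (ListedPoly F n d)

namespace PESInstance

variable {F : Type} [Field F] {d : ℕ}

/-- The polynomials have a common root. -/
def Solvable (E : PESInstance F d) : Prop :=
  ∃ x : Fin E.n → F, ∀ P ∈ E.polys, MvPolynomial.eval x P.poly = 0

/-- A system is encoded by the number of variables, the number of polynomials, and the
polynomials. -/
def encode {q : ℕ} (e : F ≃ Fin q) (E : PESInstance F d) : List ℕ :=
  E.n :: E.polys.length :: E.polys.flatMap (ListedPoly.encode e)

end PESInstance

/-- The problem of solving systems of polynomial equations of degree at most `d` over the field `F`
with `q` elements, which are represented by the numbers `0, …, q - 1` by means of `e`. -/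
def PES (F : Type) [Field F] {q : ℕ} (e : F ≃ Fin q) (d : ℕ) : DecisionProblem where
  Inst := PESInstance F d
  numVars E := E.n
  encode E := E.encode e
  Yes E := E.Solvable

/-! The Boolean variables are cut into blocks of `b`, and each block is replaced by `a` variables
over `F`, where `2 ^ b ≤ q ^ a < 2 ^ (b + 1)`. Some decoding of `Fin a → F` hits every pattern of
`b` bits (`exists_decoding`), so the values of the field variables describe all assignments. A
clause of width `k` meets at most `k` blocks, so its falsity is a function of at most `k * a` field
variables. Such a function is a polynomial of degree less than `q` in each variable
(`MvPolynomial.exists_eval_eq`), hence of total degree at most `k * a * (q - 1)` and with at most `q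
^ (k * a)` monomials: constants, once `k`, `a`, `q` are fixed. Common roots decode to satisfying
assignments, and every satisfying assignment arises so (`satisfiable_iff_of_forall₂_represents`).

Rounding `q ^ a` to a power of two loses less than one bit per block. With `η = min δ 1` and `b ≥ 2
/ η` this costs only half of the saving: the exponential factor for the system is at most a constant
times `2 ^ ((1 - η / 2) n)` (`rpow_blocks_le`). Clauses are distinct, so all sizes are polynomial in
`n` (`KCNF.size_le`), and polynomial factors are absorbed by `2 ^ (η n / 4)`. The resulting time
`O(2 ^ ((1 - η / 4) n))` for every `k`-SAT contradicts SETH.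

The reduction itself must be a word-RAM program. Up to the actual block numbers there are finitely
many shapes of clauses, so all polynomials are constants in the program text and a clause is
converted by loop-free code in constant time (`Reaches.readLiterals`, `exec_convert`). The given
algorithm is then run on fresh registers and on the output array by renaming (`Exec.rename`). -/

namespace WordRAM

/-! ## Executions -/

/-- `W` enters only through upper bounds on values. The given algorithm is analysed for its own word
size and then run with the larger words of the combined program. -/
theorem Exec.mono {W W' : ℕ} (h : W ≤ W') {p : Prog} {s s' : State} {t : ℕ}
    (hE : Exec W p s t s') : Exec W' p s t s' := by
  induction hE with
  | skip s => exact .skip s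
  | const x c s hc => exact .const x c s (hc.trans_le h)
  | op x o y z s hw => exact .op x o y z s (hw.trans_le h)
  | load x a i s hw => exact .load x a i s (hw.trans_le h)
  | store a i x s hw => exact .store a i x s (hw.trans_le h)
  | dictNew g v s hw => exact .dictNew g v s (hw.trans_le h)
  | dictRead x g l s hw => exact .dictRead x g l s (hw.trans_le h)
  | dictWrite g l v s hw => exact .dictWrite g l v s (hw.trans_le h)
  | seq _ _ ih ih' => exact .seq ih ih'
  | condTrue hx _ ih => exact .condTrue hx ih
  | condFalse hx _ ih => exact .condFalse hx ih
  | loopTrue hx _ _ ih ih' => exact .loopTrue hx ih ih'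
  | loopFalse hx => exact .loopFalse hx

/-! ### Renaming arrays and registers -/

/-- Rename the arrays of a program by `f` and its registers by `g`. -/
def Prog.rename (f g : ℕ → ℕ) : Prog → Prog
  | .skip => .skip
  | .const x c => .const (g x) c
  | .op x o y z => .op (g x) o (g y) (g z)
  | .load x a i => .load (g x) (f a) (g i)
  | .store a i x => .store (f a) (g i) (g x)
  | .dictNew h v => .dictNew (g h) (g v)
  | .dictRead x h l => .dictRead (g x) (g h) (g l)
  | .dictWrite h l v => .dictWrite (g h) (g l) (g v)
  | .seq p p' => .seq (p.rename f g) (p'.rename f g)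
  | .cond x p p' => .cond (g x) (p.rename f g) (p'.rename f g)
  | .loop x p => .loop (g x) (p.rename f g)

/-- The state `s'` contains a copy of `s` with arrays renamed by `f` and registers by `g`. -/
structure State.Embeds (f g : ℕ → ℕ) (s s' : State) : Prop where
  reg : ∀ x, s'.reg (g x) = s.reg x
  arr : ∀ a, s'.arr (f a) = s.arr a
  dict : s'.dict = s.dict

namespace State.Embeds

variable {f g : ℕ → ℕ} {s s' : State}

theorem setReg (hg : g.Injective) (h : Embeds f g s s') (x v : ℕ) :
    Embeds f g (s.setReg x v) (s'.setReg (g x) v) where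
  reg y := by
    simp only [State.setReg, Function.update_apply, hg.eq_iff, h.reg]
  arr := h.arr
  dict := h.dict

theorem setArr (hf : f.Injective) (h : Embeds f g s s') (a i v : ℕ) :
    Embeds f g (s.setArr a i v) (s'.setArr (f a) i v) where
  reg := h.reg
  arr b := by
    simp only [State.setArr, Function.update_apply, hf.eq_iff, h.arr]
  dict := h.dict

theorem setDict (h : Embeds f g s s') (i : ℕ) (D : List ℕ → ℕ) :
    Embeds f g (s.setDict i D) (s'.setDict i D) where
  reg := h.reg
  arr := h.arr
  dict := by simp only [State.setDict, h.dict]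

/-- The machine hard-wires array `1` as the query array, so a renaming of arrays has to fix it. -/
theorem key (hf1 : f 1 = 1) (h : Embeds f g s s') (l : ℕ) : s'.key l = s.key l := by
  have := h.arr 1
  rw [hf1] at this
  simp only [State.key, this]

end State.Embeds

/-- A renamed program simulates the original one. -/
theorem Exec.rename {f g : ℕ → ℕ} (hf : f.Injective) (hg : g.Injective) (hf1 : f 1 = 1) {W : ℕ}
    {p : Prog} {s u : State} {t : ℕ} (hE : Exec W p s t u) :
    ∀ {s' : State}, s.Embeds f g s' →
      ∃ u', Exec W (p.rename f g) s' t u' ∧ u.Embeds f g u' := by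
  induction hE with
  | skip s => exact fun h => ⟨_, .skip _, h⟩
  | const x c s hc => exact fun h => ⟨_, .const _ _ _ hc, h.setReg hg _ _⟩
  | op x o y z s hw =>
    intro s' h
    rw [← h.reg, ← h.reg] at hw ⊢
    exact ⟨_, .op _ _ _ _ _ hw, h.setReg hg _ _⟩
  | load x a i s hw =>
    intro s' h
    rw [← h.reg, ← h.arr] at hw ⊢
    exact ⟨_, .load _ _ _ _ hw, h.setReg hg _ _⟩
  | store a i x s hw =>
    intro s' h
    rw [← h.reg x] at hw ⊢
    rw [← h.reg i]
    exact ⟨_, .store _ _ _ _ hw, h.setArr hf _ _ _⟩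
  | dictNew i v s hw =>
    intro s' h
    rw [← h.reg v] at hw ⊢
    rw [← h.reg i]
    exact ⟨_, .dictNew _ _ _ hw, h.setDict _ _⟩
  | dictRead x i l s hw =>
    intro s' h
    rw [← h.reg l, ← h.reg i, ← h.dict, ← h.key hf1] at hw ⊢
    exact ⟨_, .dictRead _ _ _ _ hw, h.setReg hg _ _⟩
  | dictWrite i l v s hw =>
    intro s' h
    rw [← h.reg v] at hw ⊢
    rw [← h.reg l, ← h.reg i, ← h.dict, ← h.key hf1]
    exact ⟨_, .dictWrite _ _ _ _ hw, h.setDict _ _⟩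
  | seq _ _ ih ih' =>
    intro s' h
    obtain ⟨u, hu, h'⟩ := ih h
    obtain ⟨v, hv, h''⟩ := ih' h'
    exact ⟨v, .seq hu hv, h''⟩
  | condTrue hx _ ih =>
    intro s' h
    obtain ⟨u, hu, h'⟩ := ih h
    exact ⟨u, .condTrue (by rwa [h.reg]) hu, h'⟩
  | condFalse hx _ ih =>
    intro s' h
    obtain ⟨u, hu, h'⟩ := ih h
    exact ⟨u, .condFalse (by rwa [h.reg]) hu, h'⟩
  | loopTrue hx _ _ ih ih' =>
    intro s' h
    obtain ⟨u, hu, h'⟩ := ih h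
    obtain ⟨v, hv, h''⟩ := ih' h'
    exact ⟨v, .loopTrue (by rwa [h.reg]) hu hv, h''⟩
  | loopFalse hx =>
    intro s' h
    exact ⟨_, .loopFalse (by rwa [h.reg]), h⟩

/-! ### Programs without loops -/

/-- The program contains no loop. -/
def Prog.LoopFree : Prog → Prop
  | .seq p p' => p.LoopFree ∧ p'.LoopFree
  | .cond _ p p' => p.LoopFree ∧ p'.LoopFree
  | .loop _ _ => False
  | _ => True

/-- A bound for the running time of a program without loops. -/
def Prog.cost : Prog → ℕ
  | .seq p p' => p.cost + p'.cost
  | .cond _ p p' => p.cost + p'.cost + 1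
  | _ => 1

/-- Without loops the time is bounded by the program text alone. This is why `Reaches` can forget
running times: only the loop over the clauses has to be timed by hand. -/
theorem Exec.le_cost {W : ℕ} {p : Prog} {s s' : State} {t : ℕ} (hE : Exec W p s t s') :
    p.LoopFree → t ≤ p.cost := by
  induction hE with
  | seq _ _ ih ih' => exact fun h => add_le_add (ih h.1) (ih' h.2)
  | condTrue hx _ ih =>
    intro h
    have := ih h.1
    simp only [Prog.cost]
    omega
  | condFalse hx _ ih =>
    intro h
    have := ih h.2
    simp only [Prog.cost]
    omega
  | loopTrue => exact fun h => h.elim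
  | loopFalse => exact fun h => h.elim
  | _ => exact fun _ => le_rfl

/-! ### Reachability -/

/-- The program `p`, started in `s`, halts in a state with the property `Q`. -/
def Reaches (W : ℕ) (p : Prog) (s : State) (Q : State → Prop) : Prop :=
  ∃ t s', Exec W p s t s' ∧ Q s'

namespace Reaches

variable {W : ℕ} {p p' : Prog} {s : State} {Q Q' : State → Prop}

theorem imp (h : Reaches W p s Q) (hQ : ∀ s', Q s' → Q' s') : Reaches W p s Q' := by
  obtain ⟨t, s', hE, hs⟩ := h
  exact ⟨t, s', hE, hQ _ hs⟩

theorem skip (h : Q s) : Reaches W .skip s Q := ⟨_, _, .skip s, h⟩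

theorem const {x c : ℕ} (hc : c < W) (h : Q (s.setReg x c)) : Reaches W (.const x c) s Q :=
  ⟨_, _, .const x c s hc, h⟩

/-- The result is a variable `v` with an equation, so that a use can supply it in simplified form.
-/
theorem op {x y z v : ℕ} {o : BinOp} (hv : o.apply (s.reg y) (s.reg z) = v) (hw : v < W)
    (h : Q (s.setReg x v)) : Reaches W (.op x o y z) s Q := by
  subst hv
  exact ⟨_, _, .op x o y z s hw, h⟩

theorem load {x a i v : ℕ} (hv : s.arr a (s.reg i) = v) (hw : v < W) (h : Q (s.setReg x v)) :
    Reaches W (.load x a i) s Q := by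
  subst hv
  exact ⟨_, _, .load x a i s hw, h⟩

theorem store {x a i j v : ℕ} (hj : s.reg i = j) (hv : s.reg x = v) (hw : v < W)
    (h : Q (s.setArr a j v)) : Reaches W (.store a i x) s Q := by
  subst hv hj
  exact ⟨_, _, .store a i x s hw, h⟩

theorem seq (h : Reaches W p s fun s' => Reaches W p' s' Q) : Reaches W (.seq p p') s Q := by
  obtain ⟨t, s', hE, t', s'', hE', hQ⟩ := h
  exact ⟨_, _, .seq hE hE', hQ⟩

theorem cond_true {x : ℕ} (hx : s.reg x ≠ 0) (h : Reaches W p s Q) :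
    Reaches W (.cond x p p') s Q := by
  obtain ⟨t, s', hE, hQ⟩ := h
  exact ⟨_, _, .condTrue hx hE, hQ⟩

theorem cond_false {x : ℕ} (hx : s.reg x = 0) (h : Reaches W p' s Q) :
    Reaches W (.cond x p p') s Q := by
  obtain ⟨t, s', hE, hQ⟩ := h
  exact ⟨_, _, .condFalse hx hE, hQ⟩

end Reaches

namespace State

variable (s : State) (x y v a b i : ℕ)

@[simp] theorem reg_setReg : (s.setReg x v).reg y = if y = x then v else s.reg y := by
  simp [setReg, Function.update_apply]

@[simp] theorem arr_setReg : (s.setReg x v).arr = s.arr := rfl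

@[simp] theorem dict_setReg : (s.setReg x v).dict = s.dict := rfl

@[simp] theorem reg_setArr : (s.setArr a i v).reg = s.reg := rfl

@[simp] theorem arr_setArr :
    (s.setArr a i v).arr b = if b = a then Function.update (s.arr a) i v else s.arr b := by
  simp only [setArr, Function.update_apply]

end State

/-! ### Case distinctions on the content of a register -/

/-- Continue with `f v`, where `v` is the content of the register `x`, if `i ≤ v < i + m`.
The registers `5` and `9` are overwritten. -/
def Prog.switch (x : ℕ) (f : ℕ → Prog) : ℕ → ℕ → Prog
  | _, 0 => .skip
  | i, m + 1 => .seq (.const 5 i) (.seq (.op 9 .eq x 5) (.cond 9 (f i) (Prog.switch x f (i + 1) m)))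

theorem Prog.loopFree_switch {x : ℕ} {f : ℕ → Prog} (hf : ∀ i, (f i).LoopFree) (i m : ℕ) :
    (Prog.switch x f i m).LoopFree := by
  induction m generalizing i with
  | zero => trivial
  | succ m ih => exact ⟨trivial, trivial, hf i, ih _⟩

/-- The tests overwrite registers `5` and `9`; hence the property `I` carried to the selected branch
must survive writes to these two. -/
theorem Reaches.switch {W x : ℕ} {f : ℕ → Prog} {Q : State → Prop} (hx5 : x ≠ 5) (hx9 : x ≠ 9)
    (hW : 1 < W) {v : ℕ} {I : State → Prop} (hI : ∀ s c, I s → I (s.setReg 5 c))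
    (hI' : ∀ s c, I s → I (s.setReg 9 c)) (hf : ∀ s, I s → Reaches W (f v) s Q) :
    ∀ (m i : ℕ) (s : State), I s → s.reg x = v → i ≤ v → v < i + m → i + m ≤ W →
      Reaches W (Prog.switch x f i m) s Q
  | 0, i, s, _, _, h1, h2, _ => by omega
  | m + 1, i, s, hs, hx, h1, h2, h3 => by
    refine .seq (.const (by omega) (.seq ?_))
    by_cases hv : v = i
    · refine .op (v := 1) (by simp [BinOp.apply, hx5, hx, hv]) hW (.cond_true (by simp) ?_)
      subst hv
      exact hf _ (hI' _ _ (hI _ _ hs))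
    · refine .op (v := 0) (by simp [BinOp.apply, hx5, hx, hv]) (by omega) (.cond_false (by simp) ?_)
      exact Reaches.switch hx5 hx9 hW hI hI' hf m (i + 1) _ (hI' _ _ (hI _ _ hs))
        (by simp [hx5, hx9, hx]) (by omega) (by omega) (by omega)

end WordRAM

/-! ## Polynomials with prescribed values -/

section Polynomials

variable {F : Type} [Field F] {q : ℕ}

/-- Every function is given by a polynomial of degree less than `q` in each variable. -/
theorem MvPolynomial.exists_eval_eq (e : F ≃ Fin q) {σ : Type} [Finite σ] (f : (σ → F) → F) :
    ∃ P : MvPolynomial σ F, (∀ u, MvPolynomial.eval u P = f u) ∧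
      ∀ M ∈ P.support, ∀ z, M z < q := by
  have : Fintype F := Fintype.ofEquiv _ e.symm
  have hcard : Fintype.card F = q := by simp [Fintype.card_congr e]
  -- Over a finite field, evaluation maps the polynomials with all exponents at most `q - 1` onto
  -- all functions.
  have hf : f ∈ Submodule.map (MvPolynomial.evalₗ F σ)
      (MvPolynomial.restrictDegree σ F (Fintype.card F - 1)) := by
    rw [MvPolynomial.map_restrict_dom_evalₗ]
    trivial
  obtain ⟨P, hP, rfl⟩ := hf
  refine ⟨P, fun u => rfl, fun M hM z => ?_⟩
  have := (MvPolynomial.mem_restrictDegree σ P _).1 hP M hM z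
  have hq : 0 < q := hcard ▸ Fintype.card_pos
  omega

theorem MvPolynomial.totalDegree_le_card_mul {σ : Type} [Fintype σ] {P : MvPolynomial σ F}
    (hP : ∀ M ∈ P.support, ∀ z, M z < q) : P.totalDegree ≤ Fintype.card σ * (q - 1) := by
  refine Finset.sup_le fun M hM => ?_
  rw [Finsupp.sum_fintype _ _ fun _ => rfl]
  calc ∑ z, M z ≤ ∑ _z : σ, (q - 1) :=
        Finset.sum_le_sum fun z _ => by have := hP M hM z; omega
    _ = _ := by simp

theorem MvPolynomial.card_support_le {σ : Type} [Fintype σ] {P : MvPolynomial σ F}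
    (hP : ∀ M ∈ P.support, ∀ z, M z < q) : P.support.card ≤ q ^ Fintype.card σ := by
  classical
  calc P.support.card ≤ (Fintype.piFinset fun _ : σ => Finset.range q).card := by
        refine Finset.card_le_card_of_injOn (fun M z => M z) (fun M hM => ?_) fun M _ M' _ h => ?_
        · simpa using hP M hM
        · exact DFunLike.coe_injective h
    _ = _ := by simp

/-- The image of a polynomial under an injective renaming of the variables. -/
noncomputable def ListedPoly.ofRename {σ : Type} (P : MvPolynomial σ F) {n d : ℕ}
    (hd : P.totalDegree ≤ d) (φ : σ ↪ Fin n) : ListedPoly F n d where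
  poly := MvPolynomial.rename φ P
  degree_le := (MvPolynomial.totalDegree_rename_le _ _).trans hd
  monomials := P.support.toList.map (Finsupp.mapDomain φ)
  nodup := (Finset.nodup_toList _).map (Finsupp.mapDomain_injective φ.injective)
  mem_monomials M := by
    classical
    rw [MvPolynomial.support_rename_of_injective φ.injective]
    simp

/-- A monomial and its coefficient, as they are encoded. -/
noncomputable def encodeMonomial {σ : Type} {n : ℕ} (φ : σ ↪ Fin n) (c : ℕ) (M : σ →₀ ℕ) :
    List ℕ :=
  c :: List.ofFn fun i => Finsupp.mapDomain φ M i

/-- Coefficients and order of the monomials are those of `P` and do not depend on `φ`, so they can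
be constants of a program that learns `φ` only at run time. -/
theorem ListedPoly.encode_ofRename (e : F ≃ Fin q) {σ : Type} (P : MvPolynomial σ F) {n d : ℕ}
    (hd : P.totalDegree ≤ d) (φ : σ ↪ Fin n) :
    (ListedPoly.ofRename P hd φ).encode e =
      P.support.card ::
        P.support.toList.flatMap fun M => encodeMonomial φ (e (P.coeff M)) M := by
  simp only [ListedPoly.encode, ListedPoly.ofRename, List.length_map, Finset.length_toList,
    List.flatMap_map, MvPolynomial.coeff_rename_mapDomain _ φ.injective, encodeMonomial]

theorem ListedPoly.length_encode (e : F ≃ Fin q) {n d : ℕ} (P : ListedPoly F n d) :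
    (P.encode e).length = 1 + P.monomials.length * (n + 1) := by
  simp [ListedPoly.encode, List.length_flatMap, add_comm]

end Polynomials

/-! ## Writing polynomials -/

namespace WordRAM

/-- All writes agree with one target function `h`, so neither their order nor repeated positions
matter. -/
theorem foldl_update_apply {ι : Type} {p v : ι → ℕ} {h : ℕ → ℕ} (zs : List ι) (A : ℕ → ℕ) (x : ℕ)
    (hv : ∀ z ∈ zs, h (p z) = v z) :
    zs.foldl (fun A z => Function.update A (p z) (v z)) A x =
      if x ∈ zs.map p then h x else A x := by
  induction zs generalizing A with
  | nil => simp
  | cons z zs ih =>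
    rw [List.foldl_cons, ih _ fun z' hz' => hv z' (List.mem_cons_of_mem _ hz')]
    by_cases h1 : x ∈ zs.map p
    · rw [if_pos h1, if_pos (by simp only [List.map_cons, List.mem_cons]; exact .inr h1)]
    · rw [if_neg h1]
      by_cases h2 : x = p z
      · subst h2
        simp [hv z]
      · rw [Function.update_of_ne h2, if_neg]
        simp only [List.map_cons, List.mem_cons, not_or]
        exact ⟨h2, h1⟩

/-- The invariant of the reduction: array `0` holds the input `xs`, array `2` holds `A`. Register
`1` holds the number `nv` of variables of the output, register `2` a counter, registers `3` and `4`
the positions in the input and in the output, register `11` the constant `1`, and the registers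
from `12` on hold numbers of blocks of variables. Nothing else is used, apart from the registers
below `R`. -/
structure Inv (R : ℕ) (xs : List ℕ) (nv cnt pos o : ℕ) (A : ℕ → ℕ) (bs : List ℕ) (s : State) :
    Prop where
  nv : s.reg 1 = nv
  cnt : s.reg 2 = cnt
  pos : s.reg 3 = pos
  out : s.reg 4 = o
  one : s.reg 11 = 1
  bs : ∀ j < bs.length, s.reg (12 + j) = bs.getD j 0
  reg : ∀ x, R ≤ x → s.reg x = 0
  input : s.arr 0 = fun i => xs.getD i 0
  output : s.arr 2 = A
  arr : ∀ b, b ≠ 0 → b ≠ 2 → s.arr b = 0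
  dict : s.dict = fun _ _ => 0

namespace Inv

variable {R : ℕ} {xs : List ℕ} {nv cnt pos o : ℕ} {A : ℕ → ℕ} {bs : List ℕ} {s : State}

theorem scratch (hR : 12 ≤ R) (h : Inv R xs nv cnt pos o A bs s) {x : ℕ} (v : ℕ) (hx : 5 ≤ x)
    (hx' : x ≤ 10) : Inv R xs nv cnt pos o A bs (s.setReg x v) where
  nv := by rw [State.reg_setReg, if_neg (by omega), h.nv]
  cnt := by rw [State.reg_setReg, if_neg (by omega), h.cnt]
  pos := by rw [State.reg_setReg, if_neg (by omega), h.pos]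
  out := by rw [State.reg_setReg, if_neg (by omega), h.out]
  one := by rw [State.reg_setReg, if_neg (by omega), h.one]
  bs j hj := by rw [State.reg_setReg, if_neg (by omega), h.bs j hj]
  reg y hy := by rw [State.reg_setReg, if_neg (by omega), h.reg y hy]
  input := h.input
  output := h.output
  arr := h.arr
  dict := h.dict

theorem setCnt (hR : 12 ≤ R) (h : Inv R xs nv cnt pos o A bs s) (v : ℕ) :
    Inv R xs nv v pos o A bs (s.setReg 2 v) where
  nv := by rw [State.reg_setReg, if_neg (by omega), h.nv]
  cnt := by rw [State.reg_setReg, if_pos rfl]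
  pos := by rw [State.reg_setReg, if_neg (by omega), h.pos]
  out := by rw [State.reg_setReg, if_neg (by omega), h.out]
  one := by rw [State.reg_setReg, if_neg (by omega), h.one]
  bs j hj := by rw [State.reg_setReg, if_neg (by omega), h.bs j hj]
  reg y hy := by rw [State.reg_setReg, if_neg (by omega), h.reg y hy]
  input := h.input
  output := h.output
  arr := h.arr
  dict := h.dict

theorem setPos (hR : 12 ≤ R) (h : Inv R xs nv cnt pos o A bs s) (v : ℕ) :
    Inv R xs nv cnt v o A bs (s.setReg 3 v) where
  nv := by rw [State.reg_setReg, if_neg (by omega), h.nv]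
  cnt := by rw [State.reg_setReg, if_neg (by omega), h.cnt]
  pos := by rw [State.reg_setReg, if_pos rfl]
  out := by rw [State.reg_setReg, if_neg (by omega), h.out]
  one := by rw [State.reg_setReg, if_neg (by omega), h.one]
  bs j hj := by rw [State.reg_setReg, if_neg (by omega), h.bs j hj]
  reg y hy := by rw [State.reg_setReg, if_neg (by omega), h.reg y hy]
  input := h.input
  output := h.output
  arr := h.arr
  dict := h.dict

theorem setOut (hR : 12 ≤ R) (h : Inv R xs nv cnt pos o A bs s) (v : ℕ) :
    Inv R xs nv cnt pos v A bs (s.setReg 4 v) where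
  nv := by rw [State.reg_setReg, if_neg (by omega), h.nv]
  cnt := by rw [State.reg_setReg, if_neg (by omega), h.cnt]
  pos := by rw [State.reg_setReg, if_neg (by omega), h.pos]
  out := by rw [State.reg_setReg, if_pos rfl]
  one := by rw [State.reg_setReg, if_neg (by omega), h.one]
  bs j hj := by rw [State.reg_setReg, if_neg (by omega), h.bs j hj]
  reg y hy := by rw [State.reg_setReg, if_neg (by omega), h.reg y hy]
  input := h.input
  output := h.output
  arr := h.arr
  dict := h.dict

theorem pushBlock (hR : 12 + bs.length < R) (h : Inv R xs nv cnt pos o A bs s) (v : ℕ) :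
    Inv R xs nv cnt pos o A (bs ++ [v]) (s.setReg (12 + bs.length) v) where
  nv := by rw [State.reg_setReg, if_neg (by omega), h.nv]
  cnt := by rw [State.reg_setReg, if_neg (by omega), h.cnt]
  pos := by rw [State.reg_setReg, if_neg (by omega), h.pos]
  out := by rw [State.reg_setReg, if_neg (by omega), h.out]
  one := by rw [State.reg_setReg, if_neg (by omega), h.one]
  bs j hj := by
    rw [List.length_append, List.length_singleton] at hj
    rw [State.reg_setReg]
    by_cases hj' : j = bs.length
    · subst hj'
      simp
    · rw [if_neg (by omega), h.bs j (by omega), List.getD_append _ _ _ _ (by omega)]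
  reg y hy := by rw [State.reg_setReg, if_neg (by omega), h.reg y hy]
  input := h.input
  output := h.output
  arr := h.arr
  dict := h.dict

theorem dropBlocks (h : Inv R xs nv cnt pos o A bs s) : Inv R xs nv cnt pos o A [] s :=
  { h with bs := fun _ hj => absurd hj (by simp) }

theorem setOutput (h : Inv R xs nv cnt pos o A bs s) (i v : ℕ) :
    Inv R xs nv cnt pos o (Function.update A i v) bs (s.setArr 2 i v) where
  nv := h.nv
  cnt := h.cnt
  pos := h.pos
  out := h.out
  one := h.one
  bs := h.bs
  reg := h.reg
  input := by rw [State.arr_setArr, if_neg (by omega), h.input]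
  output := by rw [State.arr_setArr, if_pos rfl, h.output]
  arr b hb hb' := by rw [State.arr_setArr, if_neg hb', h.arr b hb hb']
  dict := h.dict

end Inv

/-- Append the content of register `5` to the output. -/
def Prog.emit : Prog := .seq (.store 2 4 5) (.op 4 .add 4 11)

/-- An array that is zero behind its content is a list read with default `0`; writing at the first
free cell then appends. -/
theorem update_getD_length (L : List ℕ) (v : ℕ) :
    Function.update (fun i => L.getD i 0) L.length v = fun i => (L ++ [v]).getD i 0 := by
  funext i
  rw [Function.update_apply]
  split_ifs with h
  · subst h
    simp
  · rcases Nat.lt_or_gt_of_ne h with h | h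
    · rw [List.getD_append _ _ _ _ h]
    · rw [List.getD_eq_default _ _ h.le, List.getD_eq_default]
      simp only [List.length_append, List.length_singleton]
      omega

section Emit

variable {R W : ℕ} {xs : List ℕ} {nv cnt pos : ℕ} {bs : List ℕ} {s : State}

theorem Reaches.emit (hR : 12 ≤ R) {L : List ℕ} {v : ℕ} (hs : s.reg 5 = v) (hv : v < W)
    (hL : L.length + 1 < W) (h : Inv R xs nv cnt pos L.length (fun i => L.getD i 0) bs s) :
    Reaches W .emit s (Inv R xs nv cnt pos (L ++ [v]).length (fun i => (L ++ [v]).getD i 0) bs) := by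
  refine .seq (.store h.out hs hv (.op (v := L.length + 1) ?_ hL ?_))
  · simp [BinOp.apply, h.out, h.one]
  · rw [← update_getD_length]
    simpa using (h.setOutput _ _).setOut hR _

variable {r a : ℕ}

/-- Store the exponents of a monomial in the variables `zs` behind the end of the output. -/
def Prog.emitExponents (M : Fin r × Fin a →₀ ℕ) : List (Fin r × Fin a) → Prog
  | [] => .skip
  | z :: zs => .seq (.const 5 a) <| .seq (.op 5 .mul (12 + z.1) 5) <| .seq (.op 5 .add 5 4) <|
      .seq (.const 9 z.2) <| .seq (.op 5 .add 5 9) <| .seq (.const 9 (M z)) <|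
      .seq (.store 2 5 9) (Prog.emitExponents M zs)

theorem Prog.loopFree_emitExponents (M : Fin r × Fin a →₀ ℕ) (zs : List (Fin r × Fin a)) :
    (Prog.emitExponents M zs).LoopFree := by
  induction zs with
  | nil => trivial
  | cons z zs ih => exact ⟨trivial, trivial, trivial, trivial, trivial, trivial, trivial, ih⟩

theorem Reaches.emitExponents (hR : 12 ≤ R) (hbs : bs.length = r) {M : Fin r × Fin a →₀ ℕ}
    {o : ℕ} (ha : a < W) (hM : ∀ z, M z < W)
    (hW : ∀ z : Fin r × Fin a, o + (bs.getD z.1 0 * a + z.2) < W) (zs : List (Fin r × Fin a)) :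
    ∀ {A : ℕ → ℕ} {s : State}, Inv R xs nv cnt pos o A bs s →
      Reaches W (Prog.emitExponents M zs) s (Inv R xs nv cnt pos o
        (zs.foldl (fun A z => Function.update A (o + (bs.getD z.1 0 * a + z.2)) (M z)) A) bs) := by
  induction zs with
  | nil => exact fun h => .skip h
  | cons z zs ih =>
    intro A s h
    have hz := hW z
    have hreg : s.reg (12 + z.1) = bs.getD z.1 0 := h.bs _ (hbs ▸ z.1.2)
    refine .seq (.const ha <| .seq ?_)
    refine .op (v := bs.getD z.1 0 * a) (by simp [BinOp.apply, hreg]; omega) (by omega) <| .seq ?_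
    refine .op (v := bs.getD z.1 0 * a + o) (by simp [BinOp.apply, h.out]) (by omega) <| .seq ?_
    refine .const (by omega) <| .seq ?_
    refine .op (v := bs.getD z.1 0 * a + o + z.2) (by simp [BinOp.apply]) (by omega) <| .seq ?_
    refine .const (hM z) <| .seq ?_
    refine .store (j := o + (bs.getD z.1 0 * a + z.2)) (v := M z) (by simp; omega) (by simp)
      (hM z) (ih ?_)
    refine Inv.setOutput ?_ _ _
    iterate 6 refine Inv.scratch hR ?_ _ (by omega) (by omega)
    exact h

/-- Only the exponents of variables in the blocks `bs` are written. The other cells behind the end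
have never been touched, and their default `0` is the correct exponent. So a monomial takes constant
time although its code has `n` exponents. -/
theorem foldl_update_eq_append (L : List ℕ) {n c : ℕ} (φ : Fin r × Fin a ↪ Fin n)
    (hφ : ∀ z, (φ z : ℕ) = bs.getD z.1 0 * a + z.2) (M : Fin r × Fin a →₀ ℕ) :
    Finset.univ.toList.foldl (fun A (z : Fin r × Fin a) =>
        Function.update A ((L ++ [c]).length + (bs.getD z.1 0 * a + z.2)) (M z))
      (fun i => (L ++ [c]).getD i 0) = fun i => (L ++ encodeMonomial φ c M).getD i 0 := by
  have hL : L ++ encodeMonomial φ c M =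
      (L ++ [c]) ++ List.ofFn fun i => Finsupp.mapDomain φ M i := by
    simp [encodeMonomial]
  rw [hL]
  generalize L ++ [c] = L'
  funext x
  rw [foldl_update_apply (h := fun x =>
    (L' ++ List.ofFn fun i => Finsupp.mapDomain φ M i).getD x 0)]
  · split_ifs with hx
    · rfl
    · rcases lt_or_ge x L'.length with h | h
      · rw [List.getD_append _ _ _ _ h]
      · rw [List.getD_append_right _ _ _ _ h, List.getD_eq_default _ _ h]
        rcases lt_or_ge (x - L'.length) n with h' | h'
        · rw [List.getD_eq_getElem _ _ (by simpa using h'), List.getElem_ofFn,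
            Finsupp.mapDomain_of_notMem_range]
          rintro ⟨z, hz⟩
          apply hx
          simp only [List.mem_map, Finset.mem_toList, Finset.mem_univ, true_and]
          refine ⟨z, ?_⟩
          rw [← hφ, hz]
          simp only
          omega
        · rw [List.getD_eq_default]
          simpa using h'
  · intro z _
    rw [List.getD_append_right _ _ _ _ (by omega), ← hφ, Nat.add_sub_cancel_left,
      List.getD_eq_getElem _ _ (by simp), List.getElem_ofFn]
    exact Finsupp.mapDomain_apply φ.injective _ _

/-- Append a monomial with the coefficient `c` to the output. -/
noncomputable def Prog.emitMonomial (c : ℕ) (M : Fin r × Fin a →₀ ℕ) : Prog :=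
  .seq (.const 5 c) <| .seq .emit <| .seq (.emitExponents M Finset.univ.toList) (.op 4 .add 4 1)

theorem Prog.loopFree_emitMonomial (c : ℕ) (M : Fin r × Fin a →₀ ℕ) :
    (Prog.emitMonomial c M).LoopFree :=
  ⟨trivial, ⟨trivial, trivial⟩, Prog.loopFree_emitExponents _ _, trivial⟩

theorem Reaches.emitMonomial (hR : 12 ≤ R) (hbs : bs.length = r) {L : List ℕ} {c : ℕ}
    {M : Fin r × Fin a →₀ ℕ} (φ : Fin r × Fin a ↪ Fin nv)
    (hφ : ∀ z, (φ z : ℕ) = bs.getD z.1 0 * a + z.2) (ha : a < W) (hM : ∀ z, M z < W) (hc : c < W)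
    (hW : L.length + 1 + nv < W)
    (h : Inv R xs nv cnt pos L.length (fun i => L.getD i 0) bs s) :
    Reaches W (.emitMonomial c M) s (Inv R xs nv cnt pos (L ++ encodeMonomial φ c M).length
      (fun i => (L ++ encodeMonomial φ c M).getD i 0) bs) := by
  refine .seq (.const hc <| .seq ?_)
  refine imp (.emit (v := c) hR (by simp) hc (by omega)
    (h.scratch hR c le_rfl (by omega))) fun s h => .seq ?_
  refine imp (.emitExponents hR hbs ha hM (fun z => ?_) _ h) fun s h => ?_
  · rw [← hφ, List.length_append, List.length_singleton]
    have := (φ z).2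
    omega
  · rw [foldl_update_eq_append L φ hφ] at h
    have hl : (L ++ encodeMonomial φ c M).length = (L ++ [c]).length + nv := by
      simp [encodeMonomial]
      omega
    refine .op (v := (L ++ encodeMonomial φ c M).length) (by simp [BinOp.apply, h.out, h.nv, hl]) ?_
      (h.setOut hR _)
    rw [hl, List.length_append, List.length_singleton]
    omega

variable {F : Type} [Field F] {q : ℕ}

/-- Append the monomials `Ms` of `P` to the output. -/
noncomputable def Prog.emitMonomials (e : F ≃ Fin q) (P : MvPolynomial (Fin r × Fin a) F) :
    List (Fin r × Fin a →₀ ℕ) → Prog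
  | [] => .skip
  | M :: Ms => .seq (.emitMonomial (e (P.coeff M)) M) (Prog.emitMonomials e P Ms)

theorem Prog.loopFree_emitMonomials (e : F ≃ Fin q) (P : MvPolynomial (Fin r × Fin a) F)
    (Ms : List (Fin r × Fin a →₀ ℕ)) : (Prog.emitMonomials e P Ms).LoopFree := by
  induction Ms with
  | nil => trivial
  | cons M Ms ih => exact ⟨Prog.loopFree_emitMonomial _ _, ih⟩

/-- Stating the final output as any `L'` equal to the expected list lets a caller bring it into
another form in all its occurrences at once. -/
theorem Reaches.emitMonomials (hR : 12 ≤ R) (hbs : bs.length = r) (e : F ≃ Fin q)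
    {P : MvPolynomial (Fin r × Fin a) F} (φ : Fin r × Fin a ↪ Fin nv)
    (hφ : ∀ z, (φ z : ℕ) = bs.getD z.1 0 * a + z.2) (ha : a < W) (hq : q ≤ W)
    (Ms : List (Fin r × Fin a →₀ ℕ)) :
    ∀ {L : List ℕ} {s : State}, (∀ M ∈ Ms, ∀ z, M z < q) →
      L.length + Ms.length * (nv + 1) < W →
      Inv R xs nv cnt pos L.length (fun i => L.getD i 0) bs s →
      Reaches W (.emitMonomials e P Ms) s fun s' =>
        ∀ L', L' = L ++ Ms.flatMap (fun M => encodeMonomial φ (e (P.coeff M)) M) →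
        Inv R xs nv cnt pos L'.length (fun i => L'.getD i 0) bs s' := by
  induction Ms with
  | nil =>
    rintro L s - - h
    refine .skip ?_
    rintro _ rfl
    simpa using h
  | cons M Ms ih =>
    intro L s hM hW h
    rw [List.length_cons, Nat.succ_mul] at hW
    refine .seq (imp (.emitMonomial hR hbs φ hφ ha
      (fun z => (hM M List.mem_cons_self z).trans_le hq) ((Fin.is_lt _).trans_le hq)
      (by omega) h) fun s h => ?_)
    refine imp (ih (fun M' h' => hM M' (List.mem_cons_of_mem _ h')) ?_ h) fun s h => ?_
    · simp only [List.length_append, encodeMonomial, List.length_cons, List.length_ofFn]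
      omega
    · rintro _ rfl
      refine h _ ?_
      simp

/-- Append `P` to the output. -/
noncomputable def Prog.emitPoly (e : F ≃ Fin q) (P : MvPolynomial (Fin r × Fin a) F) : Prog :=
  .seq (.const 5 P.support.card) <| .seq .emit (.emitMonomials e P P.support.toList)

theorem Prog.loopFree_emitPoly (e : F ≃ Fin q) (P : MvPolynomial (Fin r × Fin a) F) :
    (Prog.emitPoly e P).LoopFree :=
  ⟨trivial, ⟨trivial, trivial⟩, Prog.loopFree_emitMonomials _ _ _⟩

theorem Reaches.emitPoly (hR : 12 ≤ R) (hbs : bs.length = r) (e : F ≃ Fin q)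
    {P : MvPolynomial (Fin r × Fin a) F} {d : ℕ} (hd : P.totalDegree ≤ d)
    (φ : Fin r × Fin a ↪ Fin nv)
    (hφ : ∀ z, (φ z : ℕ) = bs.getD z.1 0 * a + z.2) (ha : a < W) (hq : q ≤ W)
    (hP : ∀ M ∈ P.support, ∀ z, M z < q) {L : List ℕ}
    (hc : P.support.card < W) (hW : L.length + (1 + P.support.card * (nv + 1)) < W)
    (h : Inv R xs nv cnt pos L.length (fun i => L.getD i 0) bs s) :
    Reaches W (.emitPoly e P) s
      (Inv R xs nv cnt pos (L ++ (ListedPoly.ofRename P hd φ).encode e).length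
        (fun i => (L ++ (ListedPoly.ofRename P hd φ).encode e).getD i 0) bs) := by
  refine .seq (.const hc <| .seq ?_)
  refine imp (.emit (v := P.support.card) hR (by simp) hc (by omega)
    (h.scratch hR _ le_rfl (by omega))) fun s h => ?_
  refine imp (.emitMonomials hR hbs e φ hφ ha hq _ (fun M hM => hP M (by simpa using hM)) ?_ h)
    fun s h => h _ ?_
  · simp only [List.length_append, List.length_singleton, Finset.length_toList]
    omega
  · rw [ListedPoly.encode_ofRename]
    simp

end Emit

end WordRAM

/-! ## The reduction -/

/-- The content of a block of `a` variables. -/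
def blockOf {F : Type} [Zero F] {nv : ℕ} (a : ℕ) (y : Fin nv → F) (B : ℕ) : Fin a → F :=
  fun i => if h : B * a + i < nv then y ⟨B * a + i, h⟩ else 0

/-- The polynomial `P` vanishes at `y` if and only if one of the literals is true in the assignment
that `dec` obtains from the blocks of `y`. -/
def Represents {F : Type} [Field F] {a n nv : ℕ} (b : ℕ) (dec : (Fin a → F) → ℕ → Bool)
    (C : List (Fin n × Bool)) (P : MvPolynomial (Fin nv) F) : Prop :=
  ∀ y, MvPolynomial.eval y P = 0 ↔
    ∃ l ∈ C, dec (blockOf a y ((l.1 : ℕ) / b)) ((l.1 : ℕ) % b) = l.2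

/-- The polynomial `P` is the indicator function of the event that all literals of `acc` are false.
A literal consists of the position of its block, its position in the block, and its sign. -/
structure IsTemplate {F : Type} [Field F] {a : ℕ} (q : ℕ) (dec : (Fin a → F) → ℕ → Bool) (r : ℕ)
    (acc : List (ℕ × ℕ × Bool)) (P : MvPolynomial (Fin r × Fin a) F) : Prop where
  eval_eq_zero_iff : ∀ u, MvPolynomial.eval u P = 0 ↔
    ∃ t ∈ acc, ∃ h : t.1 < r, dec (fun i => u (⟨t.1, h⟩, i)) t.2.1 = t.2.2
  lt : ∀ M ∈ P.support, ∀ z, M z < q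

theorem exists_isTemplate {F : Type} [Field F] {a q : ℕ} (e : F ≃ Fin q)
    (dec : (Fin a → F) → ℕ → Bool) (r : ℕ) (acc : List (ℕ × ℕ × Bool)) :
    ∃ P, IsTemplate q dec r acc P := by
  classical
  obtain ⟨P, hP, hP'⟩ := MvPolynomial.exists_eval_eq e fun u : Fin r × Fin a → F =>
    if ∃ t ∈ acc, ∃ h : t.1 < r, dec (fun i => u (⟨t.1, h⟩, i)) t.2.1 = t.2.2 then 0 else 1
  refine ⟨P, fun u => ?_, hP'⟩
  rw [hP]
  split_ifs with h <;> simp [h]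

/-- The embedding of the variables of the blocks `bs` into all variables. -/
def blockEmbedding {a nv : ℕ} (bs : List ℕ) (hbs : bs.Nodup) (h : ∀ B ∈ bs, (B + 1) * a ≤ nv) :
    Fin bs.length × Fin a ↪ Fin nv where
  toFun z := ⟨bs[z.1] * a + z.2, by
    have := h bs[z.1] (List.getElem_mem _)
    rw [Nat.succ_mul] at this
    have := z.2.2
    omega⟩
  inj' z z' hz := by
    have h1 : bs[z.1] * a + z.2 = bs[z'.1] * a + z'.2 := congrArg Fin.val hz
    have ha : 0 < a := z.2.pos
    -- Division by `a` recovers the block number; distinctness of the blocks then recovers its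
    -- position in `bs`.
    have h2 : bs[z.1] = bs[z'.1] := by
      have := congrArg (· / a) h1
      simpa [Nat.mul_comm _ a, Nat.mul_add_div ha, Nat.div_eq_of_lt] using this
    have h3 : z.1 = z'.1 := Fin.ext ((hbs.getElem_inj_iff).1 h2)
    rw [h2] at h1
    exact Prod.ext h3 (Fin.ext (Nat.add_left_cancel h1))

/-- In `acc` blocks are named by their position in `bs`. By `hacc`, looking up these positions gives
the literals of `C`, so placing the template's blocks at the positions `bs` turns the template into
the polynomial of the clause. -/
theorem IsTemplate.represents {F : Type} [Field F] {a q n nv b : ℕ}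
    {dec : (Fin a → F) → ℕ → Bool} {bs : List ℕ} {acc : List (ℕ × ℕ × Bool)}
    {P : MvPolynomial (Fin bs.length × Fin a) F} (hP : IsTemplate q dec bs.length acc P)
    (hbs : bs.Nodup) (hbs' : ∀ B ∈ bs, (B + 1) * a ≤ nv) {C : List (Fin n × Bool)}
    (hacc : acc.map (fun t => (bs.getD t.1 0, t.2)) =
      C.map fun l => ((l.1 : ℕ) / b, (l.1 : ℕ) % b, l.2))
    (hlt : ∀ t ∈ acc, t.1 < bs.length) :
    Represents b dec C (MvPolynomial.rename (blockEmbedding bs hbs hbs') P) := by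
  intro y
  rw [MvPolynomial.eval_rename, hP.eval_eq_zero_iff]
  have hblock : ∀ (j : ℕ) (hj : j < bs.length),
      (fun i => (y ∘ blockEmbedding bs hbs hbs') (⟨j, hj⟩, i)) = blockOf a y (bs.getD j 0) := by
    intro j hj
    funext i
    have h1 : bs.getD j 0 * a + i < nv := by
      rw [List.getD_eq_getElem _ _ hj]
      exact (blockEmbedding bs hbs hbs' (⟨j, hj⟩, i)).2
    rw [blockOf, dif_pos h1]
    refine congrArg y (Fin.ext ?_)
    simp [blockEmbedding, hj]
  have key : (∃ t ∈ acc.map (fun t => (bs.getD t.1 0, t.2)), dec (blockOf a y t.1) t.2.1 = t.2.2) ↔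
      ∃ l ∈ C, dec (blockOf a y ((l.1 : ℕ) / b)) ((l.1 : ℕ) % b) = l.2 := by
    rw [hacc]
    simp only [List.mem_map, exists_exists_and_eq_and]
  rw [← key]
  simp only [List.mem_map, exists_exists_and_eq_and]
  constructor
  · rintro ⟨t, ht, h, h'⟩
    exact ⟨t, ht, by rwa [← hblock _ h]⟩
  · rintro ⟨t, ht, h⟩
    exact ⟨t, ht, hlt t ht, by rwa [hblock]⟩

namespace WordRAM

/-! ### Reading a clause -/

/-- Continue with `found j` if the block number in register `7` is the one in register `12 + j`,
where `j` is one of the `m` numbers from `i` on, and with `new` if there is no such `j`. -/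
def Prog.matchBlock (found : ℕ → Prog) (new : Prog) : ℕ → ℕ → Prog
  | _, 0 => new
  | j, m + 1 => .seq (.op 9 .eq 7 (12 + j)) (.cond 9 (found j) (Prog.matchBlock found new (j + 1) m))

theorem Prog.loopFree_matchBlock {found : ℕ → Prog} {new : Prog} (hf : ∀ j, (found j).LoopFree)
    (hn : new.LoopFree) (j m : ℕ) : (Prog.matchBlock found new j m).LoopFree := by
  induction m generalizing j with
  | zero => exact hn
  | succ m ih => exact ⟨trivial, hf j, ih _⟩

section

variable {R W : ℕ} {xs : List ℕ} {nv cnt pos : ℕ} {bs : List ℕ}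

theorem Reaches.matchBlock {o : ℕ} {A : ℕ → ℕ} {found : ℕ → Prog} {new : Prog} {Q : State → Prop}
    (hR : 12 ≤ R) (hW : 1 < W) {B : ℕ}
    (hf : ∀ j s, j < bs.length → bs.getD j 0 = B → Inv R xs nv cnt pos o A bs s →
      Reaches W (found j) s Q)
    (hn : ∀ s, B ∉ bs → Inv R xs nv cnt pos o A bs s → s.reg 7 = B → Reaches W new s Q) (m : ℕ) :
    ∀ (j : ℕ) (s : State), Inv R xs nv cnt pos o A bs s → s.reg 7 = B → j + m = bs.length →
      (∀ i < j, bs.getD i 0 ≠ B) → Reaches W (Prog.matchBlock found new j m) s Q := by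
  induction m with
  | zero =>
    intro j s h hs hj hi
    refine hn s (fun hB => ?_) h hs
    obtain ⟨i, hi', rfl⟩ := List.getElem_of_mem hB
    exact hi i (by omega) (List.getD_eq_getElem _ _ _)
  | succ m ih =>
    intro j s h hs hj hi
    have hreg := h.bs j (by omega)
    by_cases hB : bs.getD j 0 = B
    · refine .seq (.op (v := 1) (by rw [hs, hreg, hB]; simp [BinOp.apply]) hW
        (.cond_true (by simp) ?_))
      exact hf j _ (by omega) hB (h.scratch hR _ (by omega) (by omega))
    · refine .seq (.op (v := 0) (by rw [hs, hreg]; exact if_neg (Ne.symm hB)) (by omega)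
        (.cond_false (by simp) ?_))
      refine ih _ _ (h.scratch hR _ (by omega) (by omega)) (by simp [hs]) (by omega) fun i hi' => ?_
      rcases Nat.lt_succ_iff_lt_or_eq.1 hi' with hi' | rfl
      · exact hi i hi'
      · exact hB

variable {F : Type} [Field F] {q : ℕ} {a n k : ℕ}

/-- Read `m` literals and append the resulting polynomial to the output. The literals `acc` have
been read before, and they belong to `r` different blocks. -/
noncomputable def Prog.readLiterals (e : F ≃ Fin q) (b : ℕ)
    (T : (r : ℕ) → List (ℕ × ℕ × Bool) → MvPolynomial (Fin r × Fin a) F) :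
    ℕ → ℕ → List (ℕ × ℕ × Bool) → Prog
  | 0, r, acc => .emitPoly e (T r acc)
  | m + 1, r, acc =>
    .seq (.load 6 0 3) <| .seq (.op 3 .add 3 11) <| .seq (.const 5 2) <|
    .seq (.op 10 .mod 6 5) <| .seq (.op 6 .div 6 5) <| .seq (.const 5 b) <|
    .seq (.op 7 .div 6 5) <| .seq (.op 8 .mod 6 5) <|
    .switch 10 (fun sign => .switch 8 (fun i => .matchBlock
      (fun j => Prog.readLiterals e b T m r (acc ++ [(j, i, decide (sign = 1))]))
      -- Adding the zero in register `5` copies the new block number into the next block register.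
      (.seq (.const 5 0) <| .seq (.op (12 + r) .add 7 5) <|
        Prog.readLiterals e b T m (r + 1) (acc ++ [(r, i, decide (sign = 1))]))
      0 r) 0 b) 0 2

theorem Prog.loopFree_readLiterals (e : F ≃ Fin q) (b : ℕ)
    (T : (r : ℕ) → List (ℕ × ℕ × Bool) → MvPolynomial (Fin r × Fin a) F) (m r : ℕ)
    (acc : List (ℕ × ℕ × Bool)) : (Prog.readLiterals e b T m r acc).LoopFree := by
  induction m generalizing r acc with
  | zero => exact Prog.loopFree_emitPoly _ _
  | succ m ih =>
    refine ⟨trivial, trivial, trivial, trivial, trivial, trivial, trivial, trivial, ?_⟩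
    refine Prog.loopFree_switch (fun _ => Prog.loopFree_switch (fun _ => ?_) _ _) _ _
    refine Prog.loopFree_matchBlock (fun _ => ih _ _) ?_ _ _
    exact ⟨trivial, trivial, ih _ _⟩

theorem drop_eq_cons {α : Type} {xs ys : List α} {pos : ℕ} {x : α} (h : xs.drop pos = x :: ys) :
    pos < xs.length ∧ (∀ x', xs.getD pos x' = x) ∧ xs.drop (pos + 1) = ys := by
  have hpos : pos < xs.length := by
    by_contra hpos
    rw [List.drop_eq_nil_of_le (not_lt.1 hpos)] at h
    exact List.noConfusion rfl (heq_of_eq h)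
  rw [List.drop_eq_getElem_cons hpos, List.cons_eq_cons] at h
  exact ⟨hpos, fun x' => by rw [List.getD_eq_getElem _ _ hpos, h.1], h.2⟩

/-- The encoding of a literal. -/
def encodeLiteral (l : Fin n × Bool) : ℕ := 2 * (l.1 : ℕ) + l.2.toNat

/-- The case distinctions turn the sign, the position in the block and the coincidence with earlier
blocks into data of the program text, so that at the end the template `T r acc` is a constant. Equal
blocks have to be recognised: the variables of a template must be renamed injectively. The induction
runs over the unread literals `C`, with the literals `C₀` already recorded in `acc`. -/
theorem Reaches.readLiterals (e : F ≃ Fin q) {b : ℕ} (hb : 0 < b)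
    {dec : (Fin a → F) → ℕ → Bool}
    {T : (r : ℕ) → List (ℕ × ℕ × Bool) → MvPolynomial (Fin r × Fin a) F}
    (hT : ∀ r acc, IsTemplate q dec r acc (T r acc)) (hnv : (n / b + 1) * a ≤ nv)
    (hW : xs.length + 2 * n + a + b + q + k + 3 ≤ W) {L : List ℕ}
    (hL : L.length + (1 + q ^ (k * a) * (nv + 1)) < W) (ys : List ℕ) (C : List (Fin n × Bool)) :
    ∀ (C₀ : List (Fin n × Bool)) (pos : ℕ) (bs : List ℕ) (acc : List (ℕ × ℕ × Bool)) (s : State),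
      bs.length + C.length ≤ k → bs.Nodup → (∀ B ∈ bs, (B + 1) * a ≤ nv) →
      acc.map (fun t => (bs.getD t.1 0, t.2)) =
        C₀.map (fun l => ((l.1 : ℕ) / b, (l.1 : ℕ) % b, l.2)) →
      (∀ t ∈ acc, t.1 < bs.length) →
      xs.drop pos = C.map encodeLiteral ++ ys →
      Inv (12 + k) xs nv cnt pos L.length (fun i => L.getD i 0) bs s →
      Reaches W (.readLiterals e b T C.length bs.length acc) s fun s' =>
        ∃ P : ListedPoly F nv (k * a * (q - 1)), P.monomials.length ≤ q ^ (k * a) ∧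
          Represents b dec (C₀ ++ C) P.poly ∧
          Inv (12 + k) xs nv cnt (pos + C.length) (L ++ P.encode e).length
            (fun i => (L ++ P.encode e).getD i 0) [] s' := by
  have hq : 0 < q := (e 0).pos
  induction C with
  | nil =>
    intro C₀ pos bs acc s hk hbs hbs' hacc hlt _ h
    have hk' : bs.length ≤ k := by simpa using hk
    have hT' := hT bs.length acc
    -- At most `k` blocks have been met, so the template has at most `k * a` variables.
    have hd : (T bs.length acc).totalDegree ≤ k * a * (q - 1) := by
      refine (MvPolynomial.totalDegree_le_card_mul hT'.lt).trans ?_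
      simp only [Fintype.card_prod, Fintype.card_fin]
      gcongr
    have hS : (T bs.length acc).support.card ≤ q ^ (k * a) := by
      refine (MvPolynomial.card_support_le hT'.lt).trans ?_
      simp only [Fintype.card_prod, Fintype.card_fin]
      exact Nat.pow_le_pow_right hq (by gcongr)
    have hS' := Nat.mul_le_mul_right (nv + 1) hS
    have hS'' : (T bs.length acc).support.card ≤ (T bs.length acc).support.card * (nv + 1) :=
      Nat.le_mul_of_pos_right _ (Nat.succ_pos nv)
    refine imp (.emitPoly (by omega) rfl e hd (blockEmbedding bs hbs hbs') (fun z => ?_)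
      (by omega) (by omega) hT'.lt (by omega) (by omega) h) fun s h => ?_
    · rw [List.getD_eq_getElem _ _ z.1.2]
      rfl
    · refine ⟨_, ?_, ?_, h.dropBlocks⟩
      · simpa [ListedPoly.ofRename] using hS
      · rw [List.append_nil]
        exact hT'.represents hbs hbs' hacc hlt
  | cons l C ih =>
    intro C₀ pos bs acc s hk hbs hbs' hacc hlt hxs h
    rw [List.length_cons] at hk
    rw [List.map_cons, List.cons_append] at hxs
    obtain ⟨hpos, hx, hxs⟩ := drop_eq_cons hxs
    have hl := l.1.2
    have hsign : l.2.toNat < 2 := Bool.toNat_lt l.2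
    have hdiv : (l.1 : ℕ) / b ≤ l.1 := Nat.div_le_self _ _
    have hmod : (l.1 : ℕ) % b < b := Nat.mod_lt _ hb
    have hpos' : pos + 1 + C.length = pos + (C.length + 1) := by omega
    rw [List.length_cons, Prog.readLiterals]
    refine .seq (.load (v := encodeLiteral l) (by rw [h.input, h.pos]; exact hx 0)
      (by unfold encodeLiteral; omega) <| .seq ?_)
    refine .op (v := pos + 1) (by simp [BinOp.apply, h.pos, h.one]) (by omega) <| .seq ?_
    refine .const (by omega) <| .seq ?_
    refine .op (v := l.2.toNat) (by simp [BinOp.apply, encodeLiteral]; omega) (by omega) <| .seq ?_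
    refine .op (v := (l.1 : ℕ)) (by simp [BinOp.apply, encodeLiteral]; omega) (by omega) <| .seq ?_
    refine .const (by omega) <| .seq ?_
    refine .op (v := (l.1 : ℕ) / b) (by simp [BinOp.apply]) (by omega) <| .seq ?_
    refine .op (v := (l.1 : ℕ) % b) (by simp [BinOp.apply]) (by omega) ?_
    refine Reaches.switch (v := l.2.toNat) (by omega) (by omega) (by omega)
      (I := fun s => Inv (12 + k) xs nv cnt (pos + 1) L.length (fun i => L.getD i 0) bs s ∧
        s.reg 7 = (l.1 : ℕ) / b ∧ s.reg 8 = (l.1 : ℕ) % b)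
      (fun s c hs => ⟨hs.1.scratch (by omega) c (by omega) (by omega), by simpa using hs.2⟩)
      (fun s c hs => ⟨hs.1.scratch (by omega) c (by omega) (by omega), by simpa using hs.2⟩)
      ?_ 2 0 _ ?_ (by simp) (by omega) (by omega) (by omega)
    swap
    · refine ⟨?_, by simp, by simp⟩
      iterate 6 refine Inv.scratch (by omega) ?_ _ (by omega) (by omega)
      exact (h.scratch (by omega) _ (by omega) (by omega)).setPos (by omega) _
    rintro s ⟨h, h7, h8⟩
    refine Reaches.switch (v := (l.1 : ℕ) % b) (by omega) (by omega) (by omega)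
      (I := fun s => Inv (12 + k) xs nv cnt (pos + 1) L.length (fun i => L.getD i 0) bs s ∧
        s.reg 7 = (l.1 : ℕ) / b)
      (fun s c hs => ⟨hs.1.scratch (by omega) c (by omega) (by omega), by simpa using hs.2⟩)
      (fun s c hs => ⟨hs.1.scratch (by omega) c (by omega) (by omega), by simpa using hs.2⟩)
      ?_ b 0 _ ⟨h, h7⟩ h8 (by omega) (by omega) (by omega)
    rintro s ⟨h, h7⟩
    have hdec : decide (l.2.toNat = 1) = l.2 := by cases l.2 <;> rfl
    rw [hdec]
    refine Reaches.matchBlock (B := (l.1 : ℕ) / b) (by omega) (by omega) ?_ ?_ bs.length 0 s h h7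
      (by omega) (by omega)
    · intro j s hj hB h
      refine imp (ih (C₀ ++ [l]) _ bs _ _ (by omega) hbs hbs' ?_ ?_ hxs h) ?_
      · simp only [List.map_append, hacc, List.map_cons, List.map_nil, hB]
      · simp only [List.mem_append, List.mem_singleton]
        rintro t (ht | rfl)
        · exact hlt t ht
        · exact hj
      · rintro s ⟨P, hP, hP', h⟩
        exact ⟨P, hP, by simpa using hP', by rwa [hpos'] at h⟩
    · intro s hB h h7
      refine .seq (.const (by omega) <| .seq ?_)
      refine .op (v := (l.1 : ℕ) / b) (by simp [BinOp.apply, h7]) (by omega) ?_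
      have h' := (h.scratch (by omega) 0 le_rfl (by omega)).pushBlock (by omega) ((l.1 : ℕ) / b)
      have hlen : (bs ++ [(l.1 : ℕ) / b]).length = bs.length + 1 := by simp
      rw [← hlen]
      refine imp (ih (C₀ ++ [l]) _ _ _ _ (by omega) ?_ ?_ ?_ ?_ hxs h') ?_
      · rw [List.nodup_append]
        refine ⟨hbs, List.nodup_singleton _, ?_⟩
        rintro B hB' _ hB'' rfl
        exact hB (List.mem_singleton.1 hB'' ▸ hB')
      · simp only [List.mem_append, List.mem_singleton]
        rintro B (hB | rfl)
        · exact hbs' B hB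
        · refine le_trans ?_ hnv
          gcongr
      · rw [List.map_append, List.map_append, ← hacc]
        congr 1
        · refine List.map_congr_left fun t ht => ?_
          rw [List.getD_append _ _ _ _ (hlt t ht)]
        · simp
      · simp only [List.mem_append, List.mem_singleton, hlen]
        rintro t (ht | rfl)
        · exact (hlt t ht).trans (Nat.lt_succ_self _)
        · exact Nat.lt_succ_self _
      · rintro s ⟨P, hP, hP', h⟩
        exact ⟨P, hP, by simpa using hP', by rwa [hpos'] at h⟩

end

end WordRAM

/-- Even an empty clause contributes one word, its length. -/
theorem KCNF.length_clauses_le_length_encode {k : ℕ} (φ : KCNF k) :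
    φ.clauses.length ≤ φ.encode.length := by
  have : φ.clauses.length ≤ (φ.clauses.flatMap KCNF.encodeClause).length := by
    rw [List.length_flatMap]
    have := List.card_nsmul_le_sum (φ.clauses.map fun C => (KCNF.encodeClause C).length) 1
      (by simp [KCNF.encodeClause])
    simpa using this
  simp only [KCNF.encode, List.length_cons]
  omega

namespace WordRAM

section

variable {W : ℕ} {xs : List ℕ} {nv : ℕ} {F : Type} [Field F] {q : ℕ} {a b n k : ℕ}

/-! ### Processing all clauses -/

/-- Read a clause and append the resulting polynomial to the output. -/
noncomputable def Prog.convertClause (e : F ≃ Fin q) (b k : ℕ)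
    (T : (r : ℕ) → List (ℕ × ℕ × Bool) → MvPolynomial (Fin r × Fin a) F) : Prog :=
  .seq (.load 10 0 3) <| .seq (.op 3 .add 3 11) <|
    .seq (.switch 10 (fun m => .readLiterals e b T m 0 []) 0 (k + 1)) (.op 2 .sub 2 11)

theorem Prog.loopFree_convertClause (e : F ≃ Fin q) (b k : ℕ)
    (T : (r : ℕ) → List (ℕ × ℕ × Bool) → MvPolynomial (Fin r × Fin a) F) :
    (Prog.convertClause e b k T).LoopFree :=
  ⟨trivial, trivial, Prog.loopFree_switch (fun _ => Prog.loopFree_readLiterals _ _ _ _ _ _) _ _,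
    trivial⟩

/-- The clause length is one of `0, …, k`, so `k + 1` tests select code for exactly that many
literals, and no loop over literals is needed. -/
theorem Reaches.convertClause (e : F ≃ Fin q) (hb : 0 < b)
    {dec : (Fin a → F) → ℕ → Bool}
    {T : (r : ℕ) → List (ℕ × ℕ × Bool) → MvPolynomial (Fin r × Fin a) F}
    (hT : ∀ r acc, IsTemplate q dec r acc (T r acc)) (hnv : (n / b + 1) * a ≤ nv)
    (hW : xs.length + 2 * n + a + b + q + k + 3 ≤ W) {L : List ℕ}
    (hL : L.length + (1 + q ^ (k * a) * (nv + 1)) < W) {ys : List ℕ} {C : List (Fin n × Bool)}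
    (hC : C.length ≤ k) {cnt pos : ℕ} {s : State} (hcnt : cnt + 1 < W)
    (hxs : xs.drop pos = KCNF.encodeClause C ++ ys)
    (h : Inv (12 + k) xs nv (cnt + 1) pos L.length (fun i => L.getD i 0) [] s) :
    Reaches W (.convertClause e b k T) s fun s' =>
      ∃ P : ListedPoly F nv (k * a * (q - 1)), P.monomials.length ≤ q ^ (k * a) ∧
        Represents b dec C P.poly ∧ ∃ pos', xs.drop pos' = ys ∧
        Inv (12 + k) xs nv cnt pos' (L ++ P.encode e).length
          (fun i => (L ++ P.encode e).getD i 0) [] s' := by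
  obtain ⟨hpos, hx, hxs⟩ := drop_eq_cons (show xs.drop pos = C.length :: (C.map encodeLiteral ++ ys)
    from hxs)
  refine .seq (.load (v := C.length) (by rw [h.input, h.pos]; exact hx 0) (by omega) <| .seq ?_)
  refine .op (v := pos + 1) (by simp [BinOp.apply, h.pos, h.one]) (by omega) <| .seq ?_
  refine Reaches.switch (v := C.length) (by omega) (by omega) (by omega)
    (I := fun s => Inv (12 + k) xs nv (cnt + 1) (pos + 1) L.length (fun i => L.getD i 0) [] s)
    (fun s c hs => hs.scratch (by omega) c (by omega) (by omega))
    (fun s c hs => hs.scratch (by omega) c (by omega) (by omega))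
    (fun s h => ?_) (k + 1) 0 _
    ((h.scratch (by omega) _ (by omega) (by omega)).setPos (by omega) _)
    (by simp) (by omega) (by omega) (by omega)
  refine imp (Reaches.readLiterals e hb hT hnv hW hL ys C [] _ [] [] s (by simpa using hC)
    List.nodup_nil (by simp) rfl (by simp) hxs h) ?_
  rintro s ⟨P, hP, hP', h⟩
  refine .op (v := cnt) (by simp [BinOp.apply, h.cnt, h.one]) (by omega)
    ⟨P, hP, hP', _, ?_, h.setCnt (by omega) _⟩
  rw [← List.drop_drop, hxs, List.drop_left' (by simp)]

/-- The body is loop-free, so each clause costs a constant and the total is linear in the number of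
clauses. -/
theorem exec_loop_convertClause (e : F ≃ Fin q) (hb : 0 < b)
    {dec : (Fin a → F) → ℕ → Bool}
    {T : (r : ℕ) → List (ℕ × ℕ × Bool) → MvPolynomial (Fin r × Fin a) F}
    (hT : ∀ r acc, IsTemplate q dec r acc (T r acc)) (hnv : (n / b + 1) * a ≤ nv)
    (hW : xs.length + 2 * n + a + b + q + k + 3 ≤ W) (cs : List (List (Fin n × Bool))) :
    ∀ (L : List ℕ) (pos : ℕ) (s : State),
      L.length + cs.length * (1 + q ^ (k * a) * (nv + 1)) < W → (∀ C ∈ cs, C.length ≤ k) →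
      xs.drop pos = cs.flatMap KCNF.encodeClause →
      Inv (12 + k) xs nv cs.length pos L.length (fun i => L.getD i 0) [] s →
      ∃ t s', Exec W (.loop 2 (.convertClause e b k T)) s t s' ∧
        t ≤ ((Prog.convertClause e b k T).cost + 1) * cs.length + 1 ∧
        ∃ Ps : List (ListedPoly F nv (k * a * (q - 1))),
          (∀ P ∈ Ps, P.monomials.length ≤ q ^ (k * a)) ∧
          List.Forall₂ (fun C P => Represents b dec C P.poly) cs Ps ∧
          ∃ pos' L', L' = L ++ Ps.flatMap (ListedPoly.encode e) ∧
            Inv (12 + k) xs nv 0 pos' L'.length (fun i => L'.getD i 0) [] s' := by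
  induction cs with
  | nil =>
    intro L pos s _ _ _ h
    exact ⟨1, s, .loopFalse h.cnt, by simp, [], by simp, .nil, pos, L, by simp, h⟩
  | cons C cs ih =>
    intro L pos s hL hC hxs h
    rw [List.length_cons, Nat.succ_mul] at hL
    have hcs : cs.length ≤ cs.length * (1 + q ^ (k * a) * (nv + 1)) :=
      Nat.le_mul_of_pos_right _ (by omega)
    obtain ⟨t₁, s₁, hE₁, P, hP, hP', pos₁, hxs₁, h₁⟩ := Reaches.convertClause e hb hT hnv hW
      (by omega) (hC C List.mem_cons_self) (by omega) hxs h
    have hlen : (P.encode e).length ≤ 1 + q ^ (k * a) * (nv + 1) := by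
      rw [ListedPoly.length_encode]
      gcongr
    obtain ⟨t₂, s₂, hE₂, ht₂, Ps, hPs, hPs', pos₂, L', rfl, h₂⟩ := ih _ pos₁ s₁
      (by rw [List.length_append]; omega) (fun C' h' => hC C' (List.mem_cons_of_mem _ h')) hxs₁ h₁
    have ht₁ := hE₁.le_cost (Prog.loopFree_convertClause _ _ _ _)
    refine ⟨_, s₂, .loopTrue (by rw [h.cnt]; simp) hE₁ hE₂, ?_, P :: Ps, ?_, .cons hP' hPs', pos₂,
      _, rfl, ?_⟩
    · rw [List.length_cons, Nat.mul_succ]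
      omega
    · simp only [List.mem_cons]
      rintro P' (rfl | h')
      · exact hP
      · exact hPs P' h'
    · simpa using h₂

/-! ### The complete reduction -/

/-- Write the number of variables and the number of polynomials. -/
def Prog.convertHeader (a b : ℕ) : Prog :=
  .seq (.const 11 1) <| .seq (.load 1 0 3) <| .seq (.op 3 .add 3 11) <| .seq (.load 2 0 3) <|
  .seq (.op 3 .add 3 11) <| .seq (.const 5 b) <| .seq (.op 1 .div 1 5) <|
  .seq (.op 1 .add 1 11) <| .seq (.const 5 a) <| .seq (.op 1 .mul 1 5) <|
  -- Register `4` is still `0`, so this copies the number of variables.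
  .seq (.op 5 .add 1 4) <| .seq .emit <| .seq (.const 5 0) <| .seq (.op 5 .add 2 5) .emit

theorem Prog.loopFree_convertHeader (a b : ℕ) : (Prog.convertHeader a b).LoopFree := by
  simp [Prog.convertHeader, Prog.emit, Prog.LoopFree]

theorem Reaches.convertHeader {φ : KCNF k}
    (hW : φ.encode.length + 2 * φ.n + a + b + k + 3 ≤ W) (hW' : (φ.n / b + 1) * a + 2 < W) :
    Reaches W (.convertHeader a b) (State.initial φ.encode)
      (Inv (12 + k) φ.encode ((φ.n / b + 1) * a) φ.clauses.length 2 2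
        (fun i => [(φ.n / b + 1) * a, φ.clauses.length].getD i 0) []) := by
  have hm : φ.clauses.length < W := by
    have := φ.length_clauses_le_length_encode
    omega
  have hdiv : φ.n / b ≤ φ.n := Nat.div_le_self _ _
  refine .seq (.const (by omega) <| .seq ?_)
  refine .load (v := φ.n) (by simp [State.initial, KCNF.encode]) (by omega) <| .seq ?_
  refine .op (v := 1) (by simp [BinOp.apply, State.initial]) (by omega) <| .seq ?_
  refine .load (v := φ.clauses.length) (by simp [State.initial, KCNF.encode]) hm <| .seq ?_
  refine .op (v := 2) (by simp [BinOp.apply]) (by omega) <| .seq ?_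
  refine .const (by omega) <| .seq ?_
  refine .op (v := φ.n / b) (by simp [BinOp.apply]) (by omega) <| .seq ?_
  refine .op (v := φ.n / b + 1) (by simp [BinOp.apply]) (by omega) <| .seq ?_
  refine .const (by omega) <| .seq ?_
  refine .op (v := (φ.n / b + 1) * a) (by simp [BinOp.apply]) (by omega) <| .seq ?_
  refine .op (v := (φ.n / b + 1) * a) (by simp [BinOp.apply, State.initial]) (by omega) <| .seq ?_
  refine imp (.emit (R := 12 + k) (xs := φ.encode) (nv := (φ.n / b + 1) * a)
    (cnt := φ.clauses.length) (pos := 2) (bs := []) (L := []) (by omega) (by simp; rfl) (by omega)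
    (by simp; omega) ?_) fun s h => .seq (.const (by omega) (.seq ?_))
  · constructor <;> try simp [State.initial]
    · intro x hx
      simp only [show ∀ c, c < 12 → x ≠ c from fun c hc => by omega, Nat.reduceLT, if_false]
    · intro b hb _
      funext i
      simp [hb]
  · refine .op (v := φ.clauses.length) (by simp [BinOp.apply, h.cnt]) hm ?_
    exact .emit (by omega) (by simp) hm (by simp; omega)
      ((h.scratch (by omega) _ (by omega) (by omega)).scratch (by omega) _ (by omega) (by omega))

/-- Reduce the satisfiability of a formula to the solvability of a system of polynomials. The copy
of a program for the latter problem works on the registers from `12 + k` on. -/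
noncomputable def Prog.convert (e : F ≃ Fin q) (b k : ℕ)
    (T : (r : ℕ) → List (ℕ × ℕ × Bool) → MvPolynomial (Fin r × Fin a) F) : Prog :=
  .seq (.convertHeader a b) <| .seq (.loop 2 (.convertClause e b k T)) <|
    .seq (.const 5 0) (.op (12 + k) .add 4 5)

theorem forall_mem_iff_of_forall₂ {α β : Type} {R : α → β → Prop} {p : α → Prop} {p' : β → Prop}
    {l : List α} {l' : List β} (h : List.Forall₂ R l l') (hR : ∀ x y, R x y → (p x ↔ p' y)) :
    (∀ x ∈ l, p x) ↔ ∀ y ∈ l', p' y := by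
  induction h with
  | nil => simp
  | cons h _ ih => simp only [List.forall_mem_cons, hR _ _ h, ih]

/-- Since `dec` is defined on every block content, each `y` decodes to some assignment and no
equations are needed to exclude invalid codes. Conversely an assignment is encoded block by block.
-/
theorem satisfiable_iff_of_forall₂_represents {φ : KCNF k} {d : ℕ}
    {Ps : List (ListedPoly F ((φ.n / b + 1) * a) d)} (ha : 0 < a) (hb : 0 < b)
    {dec : (Fin a → F) → ℕ → Bool}
    (hdec : ∀ g : ℕ → Bool, ∃ u, ∀ i < b, dec u i = g i)
    (h : List.Forall₂ (fun C P => Represents b dec C P.poly) φ.clauses Ps) :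
    (∃ y, ∀ P ∈ Ps, MvPolynomial.eval y P.poly = 0) ↔ φ.Satisfiable := by
  have key (y : Fin ((φ.n / b + 1) * a) → F) : (∀ C ∈ φ.clauses, ∃ l ∈ C,
      dec (blockOf a y ((l.1 : ℕ) / b)) ((l.1 : ℕ) % b) = l.2) ↔
      ∀ P ∈ Ps, MvPolynomial.eval y P.poly = 0 :=
    forall_mem_iff_of_forall₂ h fun C P hP => (hP y).symm
  constructor
  · rintro ⟨y, hy⟩
    exact ⟨fun v => dec (blockOf a y ((v : ℕ) / b)) ((v : ℕ) % b), (key y).2 hy⟩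
  · rintro ⟨x, hx⟩
    -- Blocks may reach beyond the last Boolean variable; the surplus bits are set to `false`.
    choose u hu using fun B : ℕ => hdec fun i => if h : B * b + i < φ.n then x ⟨B * b + i, h⟩
      else false
    refine ⟨fun z => u (z / a) ⟨z % a, Nat.mod_lt _ ha⟩, (key _).1 fun C hC => ?_⟩
    obtain ⟨l, hl, hl'⟩ := hx C hC
    refine ⟨l, hl, ?_⟩
    rw [← hl']
    have hblock : blockOf a (fun z : Fin ((φ.n / b + 1) * a) => u (z / a) ⟨z % a, Nat.mod_lt _ ha⟩)
        ((l.1 : ℕ) / b) = u ((l.1 : ℕ) / b) := by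
      funext i
      have hlt : (l.1 : ℕ) / b * a + i < (φ.n / b + 1) * a := by
        have h1 : ((l.1 : ℕ) / b + 1) * a ≤ (φ.n / b + 1) * a := by
          gcongr
          exact l.1.2.le
        rw [Nat.succ_mul] at h1
        have := i.2
        omega
      rw [blockOf, dif_pos hlt]
      have h1 : ((l.1 : ℕ) / b * a + i) / a = (l.1 : ℕ) / b := by
        rw [Nat.mul_comm, Nat.mul_add_div ha, Nat.div_eq_of_lt i.2, Nat.add_zero]
      have h2 : ((l.1 : ℕ) / b * a + i) % a = i := by
        rw [Nat.mul_comm, Nat.mul_add_mod, Nat.mod_eq_of_lt i.2]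
      simp only [h1, h2]
    rw [hblock, hu _ _ (Nat.mod_lt _ hb)]
    simp [Nat.div_add_mod']

/-- Seen through the renaming, the final state is the initial state on the encoded system: the
output array `2` plays the role of array `0`, register `12 + k` holds its length, and everything
else in the range of the renaming is still zero. The old input array lies outside that range. -/
theorem exec_convert (e : F ≃ Fin q) (ha : 0 < a) (hb : 0 < b) {dec : (Fin a → F) → ℕ → Bool}
    (hdec : ∀ g : ℕ → Bool, ∃ u, ∀ i < b, dec u i = g i)
    {T : (r : ℕ) → List (ℕ × ℕ × Bool) → MvPolynomial (Fin r × Fin a) F}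
    (hT : ∀ r acc, IsTemplate q dec r acc (T r acc)) (φ : KCNF k)
    (hW : φ.encode.length + 2 * φ.n + a + b + q + k + 3 ≤ W)
    (hW' : (φ.n / b + 1) * a + 2 +
      φ.clauses.length * (1 + q ^ (k * a) * ((φ.n / b + 1) * a + 1)) < W) :
    ∃ t s, ∃ E : PESInstance F (k * a * (q - 1)),
      Exec W (.convert e b k T) (State.initial φ.encode) t s ∧
      t ≤ ((Prog.convertHeader a b).cost + (Prog.convertClause e b k T).cost + 3) *
        (φ.clauses.length + 1) ∧
      E.n = (φ.n / b + 1) * a ∧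
      (E.encode e).length ≤
        2 + φ.clauses.length * (1 + q ^ (k * a) * ((φ.n / b + 1) * a + 1)) ∧
      (State.initial (E.encode e)).Embeds (fun x => if x = 1 then 1 else x + 2)
        (fun x => x + (12 + k)) s ∧
      (E.Solvable ↔ φ.Satisfiable) := by
  obtain ⟨t₁, s₁, hE₁, h₁⟩ := Reaches.convertHeader (a := a) (b := b) (W := W) (φ := φ) (by omega)
    (by omega)
  have ht₁ := hE₁.le_cost (Prog.loopFree_convertHeader a b)
  obtain ⟨t₂, s₂, hE₂, ht₂, Ps, hPs, hPs', pos, L, hL, h₂⟩ := exec_loop_convertClause e hb hT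
    le_rfl hW φ.clauses [(φ.n / b + 1) * a, φ.clauses.length] 2 s₁
    (by simp only [List.length_cons, List.length_nil]; omega) φ.width (by simp [KCNF.encode]) h₁
  have hlen : L.length ≤
      2 + φ.clauses.length * (1 + q ^ (k * a) * ((φ.n / b + 1) * a + 1)) := by
    rw [hL, List.length_append, List.length_flatMap, hPs'.length_eq]
    simp only [List.length_cons, List.length_nil]
    gcongr
    refine (List.sum_le_card_nsmul _ (1 + q ^ (k * a) * ((φ.n / b + 1) * a + 1)) ?_).trans
      (by simp)
    simp only [List.mem_map]
    rintro _ ⟨P, hP, rfl⟩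
    rw [ListedPoly.length_encode]
    have := hPs P hP
    gcongr
  have hEnc : PESInstance.encode e ⟨(φ.n / b + 1) * a, Ps⟩ = L := by
    rw [hL, PESInstance.encode, hPs'.length_eq]
    rfl
  refine ⟨_, _, ⟨_, Ps⟩, .seq hE₁ (.seq hE₂ (.seq (.const 5 0 _ (by omega))
    (.op _ _ _ _ _ ?_))), ?_, rfl, by rwa [hEnc], ?_,
    satisfiable_iff_of_forall₂_represents ha hb hdec hPs'⟩
  · simp [BinOp.apply, h₂.out]
    omega
  · generalize (Prog.convertHeader a b).cost = c₁ at *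
    generalize (Prog.convertClause e b k T).cost = c₂ at *
    nlinarith [Nat.zero_le (c₁ * φ.clauses.length)]
  · rw [hEnc]
    refine ⟨fun x => ?_, fun x => ?_, h₂.dict⟩
    · rcases Nat.eq_zero_or_pos x with rfl | hx
      · simp [BinOp.apply, h₂.out, State.initial]
      · simp only [State.reg_setReg]
        rw [if_neg (by omega), if_neg (by omega), h₂.reg _ (by omega)]
        simp [State.initial, hx.ne']
    · simp only [State.arr_setReg]
      by_cases hx : x = 1
      · subst hx
        rw [if_pos rfl, h₂.arr 1 (by omega) (by omega)]
        rfl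
      · rw [if_neg hx]
        rcases Nat.eq_zero_or_pos x with rfl | hx'
        · rw [h₂.output]
          simp [State.initial]
        · rw [h₂.arr _ (by omega) (by omega)]
          funext i
          simp [State.initial, hx'.ne']

end

end WordRAM

/-! ## Sizes and running times -/

/-- A list of length at most `k` is determined by its optional entries at the positions below `k`,
each with `2 * n + 1` possible values; the clauses are distinct. -/
theorem KCNF.length_clauses_le {k : ℕ} (φ : KCNF k) : φ.clauses.length ≤ (2 * φ.n + 1) ^ k := by
  classical
  have hinj : Set.InjOn (fun (C : List (Fin φ.n × Bool)) (i : Fin k) => C[(i : ℕ)]?)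
      {C | C ∈ φ.clauses} := by
    intro C hC C' hC' h
    refine List.ext_getElem? fun i => ?_
    rcases lt_or_ge i k with hi | hi
    · exact congrFun h ⟨i, hi⟩
    · rw [List.getElem?_eq_none ((φ.width C hC).trans hi),
        List.getElem?_eq_none ((φ.width C' hC').trans hi)]
  have hnodup : (φ.clauses.map fun (C : List (Fin φ.n × Bool)) (i : Fin k) => C[(i : ℕ)]?).Nodup :=
    φ.nodup.map_on fun C hC C' hC' h => hinj hC hC' h
  have := hnodup.length_le_card
  simpa [mul_comm] using this

theorem KCNF.length_encode_le {k : ℕ} (φ : KCNF k) :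
    φ.encode.length ≤ 2 + φ.clauses.length * (k + 1) := by
  have : (φ.clauses.flatMap KCNF.encodeClause).length ≤ φ.clauses.length * (k + 1) := by
    rw [List.length_flatMap]
    refine (List.sum_le_card_nsmul _ (k + 1) ?_).trans (by simp)
    simp only [List.mem_map]
    rintro _ ⟨C, hC, rfl⟩
    have := φ.width C hC
    simpa [KCNF.encodeClause] using this
  simp only [KCNF.encode, List.length_cons]
  omega

/-- The input size is polynomial in the number of variables. -/
theorem KCNF.size_le {k : ℕ} (φ : KCNF k) :
    (kSAT k).size φ + 2 ≤ 2 ^ k * (k + 6) * (φ.n + 1) ^ (k + 1) := by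
  have h1 := φ.length_encode_le
  have h2 : φ.clauses.length ≤ 2 ^ k * (φ.n + 1) ^ (k + 1) :=
    calc φ.clauses.length ≤ (2 * φ.n + 1) ^ k := φ.length_clauses_le
      _ ≤ (2 * (φ.n + 1)) ^ k := by gcongr; omega
      _ = 2 ^ k * (φ.n + 1) ^ k := by rw [mul_pow]
      _ ≤ 2 ^ k * (φ.n + 1) ^ (k + 1) := by gcongr <;> omega
  -- The exponent `k + 1` instead of `k` makes this hold for `k = 0` too.
  have h3 : φ.n + 1 ≤ 2 ^ k * (φ.n + 1) ^ (k + 1) :=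
    calc φ.n + 1 = 1 * (φ.n + 1) ^ 1 := by ring
      _ ≤ _ := by gcongr <;> first | exact Nat.one_le_two_pow | omega
  have h4 : (kSAT k).size φ = φ.n + φ.encode.length := rfl
  rw [h4]
  calc φ.n + φ.encode.length + 2 ≤ 5 * (φ.n + 1) + φ.clauses.length * (k + 1) := by omega
    _ ≤ 5 * (2 ^ k * (φ.n + 1) ^ (k + 1)) + 2 ^ k * (φ.n + 1) ^ (k + 1) * (k + 1) := by gcongr
    _ = _ := by ring

theorem exists_pow_le_mul_two_rpow {ε : ℝ} (hε : 0 < ε) (j : ℕ) :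
    ∃ C : ℝ, 0 < C ∧ ∀ n : ℕ, ((n : ℝ) + 1) ^ j ≤ C * 2 ^ (ε * n) := by
  have h1 : (1 : ℝ) < 2 ^ ε := Real.one_lt_rpow one_lt_two hε
  obtain ⟨C, hC, h⟩ := Asymptotics.bound_of_isBigO_nat_atTop
    (isLittleO_pow_const_const_pow_of_one_lt (R := ℝ) j h1).isBigO
  -- The bound is applied at `n + 1`, which costs the factor `2 ^ ε`.
  refine ⟨C * 2 ^ ε, by positivity, fun n => ?_⟩
  have := h (x := n + 1) (by positivity)
  rw [Real.norm_of_nonneg (by positivity), Real.norm_of_nonneg (by positivity)] at this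
  rw [Real.rpow_mul zero_le_two, Real.rpow_natCast]
  push_cast at this
  rw [pow_succ] at this
  linarith

/-- Replacing `b` Boolean variables by `a` variables over a field with `q` elements. -/
theorem rpow_blocks_le {q a b n : ℕ} {δ η : ℝ} (hη : 0 < η) (hη1 : η ≤ 1) (hηδ : η ≤ δ)
    (hq : 2 ≤ q) (hqb : q ^ a < 2 ^ (b + 1)) (hb : 2 ≤ η * b) :
    (q : ℝ) ^ ((1 - δ) * (((n / b + 1) * a : ℕ) : ℝ)) ≤ 2 ^ b * 2 ^ ((1 - η / 2) * (n : ℝ)) := by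
  have hq1 : (1 : ℝ) ≤ q := by exact_mod_cast (by omega : 1 ≤ q)
  have hb0 : (0 : ℝ) < b := by
    by_contra h
    nlinarith [(Nat.cast_nonneg b : (0 : ℝ) ≤ b)]
  have hdiv : ((n / b : ℕ) : ℝ) * b ≤ n := by exact_mod_cast Nat.div_mul_le_self n b
  have hexp : (b + 1 : ℝ) * ((1 - η) * ((n / b : ℕ) + 1 : ℝ)) ≤ b + (1 - η / 2) * n := by
    set x : ℝ := ((n / b : ℕ) : ℝ)
    have hx : 0 ≤ x := Nat.cast_nonneg _
    -- This amounts to `1 - η ≤ η * b / 2`: blocks with `η * b ≥ 2` make up for the bit lost by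
    -- rounding.
    have h1 : (b + 1 : ℝ) * (1 - η) ≤ (1 - η / 2) * b := by nlinarith
    calc (b + 1 : ℝ) * ((1 - η) * (x + 1)) = (b + 1 : ℝ) * (1 - η) * (x + 1) := by ring
      _ ≤ (1 - η / 2) * b * (x + 1) := by gcongr
      _ = (1 - η / 2) * (x * b) + (1 - η / 2) * b := by ring
      _ ≤ (1 - η / 2) * n + 1 * b := by
        have : 0 ≤ 1 - η / 2 := by linarith
        gcongr
        linarith
      _ = _ := by ring
  calc (q : ℝ) ^ ((1 - δ) * (((n / b + 1) * a : ℕ) : ℝ))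
      ≤ (q : ℝ) ^ ((1 - η) * (((n / b + 1) * a : ℕ) : ℝ)) := by gcongr
    _ = ((q : ℝ) ^ a) ^ ((1 - η) * ((n / b : ℕ) + 1 : ℝ)) := by
      rw [← Real.rpow_natCast, ← Real.rpow_mul (by linarith)]
      push_cast
      ring_nf
    _ ≤ ((2 : ℝ) ^ (b + 1)) ^ ((1 - η) * ((n / b : ℕ) + 1 : ℝ)) := by
      have : 0 ≤ 1 - η := by linarith
      gcongr
      exact_mod_cast hqb.le
    _ = 2 ^ ((b + 1 : ℝ) * ((1 - η) * ((n / b : ℕ) + 1 : ℝ))) := by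
      rw [← Real.rpow_natCast, ← Real.rpow_mul zero_le_two]
      push_cast
      rfl
    _ ≤ 2 ^ (b + (1 - η / 2) * n) := by
      gcongr
      exact one_le_two
    _ = _ := by rw [Real.rpow_add two_pos, Real.rpow_natCast]

/-- The decoding is a left inverse of an injection of the bit patterns into the block contents. -/
theorem exists_decoding {F : Type} {q a b : ℕ} (e : F ≃ Fin q) (h : 2 ^ b ≤ q ^ a) :
    ∃ dec : (Fin a → F) → ℕ → Bool, ∀ g : ℕ → Bool, ∃ u, ∀ i < b, dec u i = g i := by
  classical
  have : Fintype F := Fintype.ofEquiv _ e.symm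
  obtain ⟨f⟩ : Nonempty ((Fin b → Bool) ↪ (Fin a → F)) := by
    rw [Function.Embedding.nonempty_iff_card_le]
    simpa [Fintype.card_congr e] using h
  refine ⟨fun u i => if hi : i < b then Function.invFun f u ⟨i, hi⟩ else false, fun g =>
    ⟨f fun i => g i, fun i hi => ?_⟩⟩
  simp only [dif_pos hi, Function.leftInverse_invFun f.injective _]

/-- Word sizes must be pure powers of the input size. Constants are therefore moved into the
exponent by `c ≤ 2 ^ c ≤ N ^ c`. The first summands are the number of variables and an extra `2`,
the bracket bounds the length of the encoding. -/
theorem reduction_size_le {q a b k n m N : ℕ} (hn : n + 1 ≤ N) (hm : m ≤ N) (hN : 2 ≤ N) :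
    (n / b + 1) * a + 2 + (2 + m * (1 + q ^ (k * a) * ((n / b + 1) * a + 1))) ≤
      N ^ (q ^ (k * a) * (a + 1) + a + 8) := by
  have h1 : (n / b + 1) * a ≤ N * a := by
    gcongr
    exact (Nat.succ_le_succ (Nat.div_le_self _ _)).trans hn
  have hN1 : 1 ≤ N := by omega
  generalize (n / b + 1) * a = x at *
  generalize q ^ (k * a) = S at *
  calc x + 2 + (2 + m * (1 + S * (x + 1)))
      ≤ N * a + 2 + (2 + N * (1 + S * (N * a + 1))) := by gcongr
    _ ≤ N * N * a + 2 * (N * N) + (2 * (N * N) + N * (N + S * (N * a + N))) := by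
      have h2 : N ≤ N * N := Nat.le_mul_self N
      have h3 : N * a ≤ N * N * a := by gcongr
      have h4 : N * (1 + S * (N * a + 1)) ≤ N * (N + S * (N * a + N)) := by gcongr
      omega
    _ = (S * (a + 1) + a + 5) * N ^ 2 := by ring
    _ ≤ N ^ (S * (a + 1) + a + 6) * N ^ 2 := by
      gcongr
      calc S * (a + 1) + a + 5 ≤ 2 ^ (S * (a + 1) + a + 6) := by
            have := (Nat.lt_two_pow_self (n := S * (a + 1) + a + 6))
            omega
        _ ≤ _ := by gcongr
    _ = _ := by rw [← pow_add]

theorem add_const_le_pow {x N c : ℕ} (hx : x ≤ 2 * N) (hN : 2 ≤ N) : x + c ≤ N ^ (c + 3) :=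
  calc x + c ≤ 2 * N + c * N := by
        have : c ≤ c * N := Nat.le_mul_of_pos_right c (by omega)
        omega
    _ = (c + 2) * N := by ring
    _ ≤ N ^ (c + 2) * N := by
      gcongr
      exact (Nat.lt_two_pow_self (n := c + 2)).le.trans (by gcongr)
    _ = _ := by rw [← pow_succ]

/-- The blocks leave the exponent `1 - η / 2`, and all polynomial factors together cost `η / 4`. The
power `G * c` of `N` comes from the algorithm run on a system of size at most `N ^ G`; the `+ 1`
covers the linear time of the reduction. -/
theorem running_time_le {n k b c D G M N t₁ t₂ : ℕ} {η C Q : ℝ} (hη : η ≤ 1) (hN : 1 ≤ N)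
    (hNn : N ≤ 2 ^ k * (k + 6) * (n + 1) ^ (k + 1))
    (hC : ((n : ℝ) + 1) ^ ((k + 1) * (G * c + 1)) ≤ C * 2 ^ (η / 4 * n))
    (h₁ : t₁ ≤ D * N) (hM : M + 1 ≤ N ^ G) (h₂ : (t₂ : ℝ) ≤ c * ((M : ℝ) + 1) ^ c * Q)
    (hQ : Q ≤ 2 ^ b * 2 ^ ((1 - η / 2) * (n : ℝ))) :
    ((t₁ + (t₂ + (1 + 1)) : ℕ) : ℝ) ≤
      (D + c * 2 ^ b + 2) * (2 ^ k * (k + 6)) ^ (G * c + 1) * C * 2 ^ ((1 - η / 4) * (n : ℝ)) := by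
  have hY : (2 : ℝ) ^ ((1 - η / 4) * (n : ℝ)) =
      2 ^ (η / 4 * (n : ℝ)) * 2 ^ ((1 - η / 2) * (n : ℝ)) := by
    rw [← Real.rpow_add two_pos]
    ring_nf
  have hZ : (1 : ℝ) ≤ 2 ^ ((1 - η / 2) * (n : ℝ)) :=
    Real.one_le_rpow one_le_two (mul_nonneg (by linarith) (Nat.cast_nonneg _))
  rw [hY]
  generalize (2 : ℝ) ^ ((1 - η / 2) * (n : ℝ)) = Z at *
  generalize (2 : ℝ) ^ (η / 4 * (n : ℝ)) = Y at *
  have hNR : (1 : ℝ) ≤ N := by exact_mod_cast hN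
  have hX : (1 : ℝ) ≤ (N : ℝ) ^ (G * c + 1) := one_le_pow₀ hNR
  have ht₁ : (t₁ : ℝ) ≤ D * (N : ℝ) ^ (G * c + 1) * Z :=
    calc (t₁ : ℝ) ≤ D * N * 1 := by
          rw [mul_one]
          exact_mod_cast h₁
      _ ≤ _ := by
        gcongr
        exact le_self_pow₀ hNR (by omega)
  have ht₂ : (t₂ : ℝ) ≤ c * 2 ^ b * (N : ℝ) ^ (G * c + 1) * Z := by
    have hs : ((M : ℝ) + 1) ^ c ≤ (N : ℝ) ^ (G * c + 1) :=
      calc ((M : ℝ) + 1) ^ c ≤ ((N : ℝ) ^ G) ^ c := by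
            gcongr
            exact_mod_cast hM
        _ = (N : ℝ) ^ (G * c) := by rw [pow_mul]
        _ ≤ _ := pow_le_pow_right₀ hNR (by omega)
    calc (t₂ : ℝ) ≤ c * ((M : ℝ) + 1) ^ c * (2 ^ b * Z) := h₂.trans (by gcongr)
      _ ≤ c * (N : ℝ) ^ (G * c + 1) * (2 ^ b * Z) := by gcongr
      _ = _ := by ring
  have hNn' : (N : ℝ) ^ (G * c + 1) ≤ (2 ^ k * (k + 6)) ^ (G * c + 1) * (C * Y) :=
    calc (N : ℝ) ^ (G * c + 1)
        ≤ (2 ^ k * (k + 6) * ((n : ℝ) + 1) ^ (k + 1)) ^ (G * c + 1) := by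
          gcongr
          exact_mod_cast hNn
      _ = (2 ^ k * (k + 6)) ^ (G * c + 1) * ((n : ℝ) + 1) ^ ((k + 1) * (G * c + 1)) := by
        rw [mul_pow, pow_mul]
      _ ≤ _ := by gcongr
  push_cast
  generalize (N : ℝ) ^ (G * c + 1) = X at *
  have h3 : 1 * 1 ≤ X * Z := mul_le_mul hX hZ zero_le_one (by linarith)
  calc (t₁ : ℝ) + (t₂ + 2) ≤ (D + c * 2 ^ b + 2) * X * Z := by linarith
    _ ≤ (D + c * 2 ^ b + 2) * ((2 ^ k * (k + 6)) ^ (G * c + 1) * (C * Y)) * Z := by gcongr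
    _ = _ := by ring

/-! ## The lower bound -/

open WordRAM in
/-- An algorithm for polynomial equation systems yields an algorithm for `k`-SAT, for all `a` and
`b` with `2 ^ b ≤ q ^ a`. -/
theorem kSAT_solvableInBigO {F : Type} [Field F] {q a b k : ℕ} (e : F ≃ Fin q) {δ η : ℝ}
    (hη : 0 < η) (hη1 : η ≤ 1) (hηδ : η ≤ δ) (hq : 2 ≤ q) (ha : 0 < a) (hqb : 2 ^ b ≤ q ^ a)
    (hqb' : q ^ a < 2 ^ (b + 1)) (hb : 2 ≤ η * b)
    (h : (PES F e (k * a * (q - 1))).SolvableInOStar fun n => (q : ℝ) ^ ((1 - δ) * (n : ℝ))) :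
    (kSAT k).SolvableInBigO fun n => (2 : ℝ) ^ ((1 - η / 4) * (n : ℝ)) := by
  obtain ⟨c, p, w, hp⟩ := h
  have hb0 : 0 < b := by
    rcases Nat.eq_zero_or_pos b with rfl | hb0
    · norm_num at hb
    · exact hb0
  obtain ⟨dec, hdec⟩ := exists_decoding e hqb
  choose T hT using exists_isTemplate e dec
  set G := q ^ (k * a) * (a + 1) + a + 8 with hG
  set D := (Prog.convertHeader a b).cost + (Prog.convertClause e b k T).cost + 3 with hD
  obtain ⟨C, hC, hpoly⟩ := exists_pow_le_mul_two_rpow (ε := η / 4) (by linarith)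
    ((k + 1) * (G * c + 1))
  -- In the word exponent, `G * w` serves the given algorithm, `G` the addresses and numbers of the
  -- output, and the last summand the constants of the reduction. The final comparison with `1`
  -- moves the answer from the renamed register `12 + k` to register `0`.
  refine ⟨(D + c * 2 ^ b + 2) * (2 ^ k * (k + 6)) ^ (G * c + 1) * C,
    .seq (.convert e b k T) (.seq
      (p.rename (fun x => if x = 1 then 1 else x + 2) fun x => x + (12 + k))
      (.seq (.const 5 1) (.op 0 .eq (12 + k) 5))), G * w + G + (a + b + q + k + 6), fun φ => ?_⟩
  set N := (kSAT k).size φ + 2 with hNdef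
  have hsize : N = φ.n + φ.encode.length + 2 := rfl
  have hm := φ.length_clauses_le_length_encode
  have hred := reduction_size_le (q := q) (a := a) (b := b) (k := k) (n := φ.n)
    (m := φ.clauses.length) (N := N) (by omega) (by omega) (by omega)
  rw [← hG] at hred
  have hN1 : 1 ≤ N := by omega
  have hW1 : N ^ G ≤ N ^ (G * w + G + (a + b + q + k + 6)) := Nat.pow_le_pow_right hN1 (by omega)
  have hW2 : N ^ (a + b + q + k + 6) ≤ N ^ (G * w + G + (a + b + q + k + 6)) :=
    Nat.pow_le_pow_right hN1 (by omega)
  have hW3 := add_const_le_pow (x := φ.encode.length + 2 * φ.n) (N := N) (c := a + b + q + k + 3)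
    (by omega) (by omega)
  set W := N ^ (G * w + G + (a + b + q + k + 6)) with hWdef
  obtain ⟨t₁, s₁, E, hE₁, ht₁, hEn, hElen, hemb, hEquiv⟩ := exec_convert (W := W) e ha hb0 hdec hT φ
    (by rw [show a + b + q + k + 3 + 3 = a + b + q + k + 6 by ring] at hW3; omega) (by omega)
  have hEsize : (PES F e (k * a * (q - 1))).size E + 2 ≤ N ^ G := by
    have : (PES F e (k * a * (q - 1))).size E = E.n + (E.encode e).length := rfl
    omega
  obtain ⟨t₂, s₂, hE₂, ht₂, hYes⟩ := hp E
  have hW4 : ((PES F e (k * a * (q - 1))).size E + 2) ^ w ≤ W :=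
    calc ((PES F e (k * a * (q - 1))).size E + 2) ^ w ≤ (N ^ G) ^ w := by gcongr
      _ = N ^ (G * w) := by rw [pow_mul]
      _ ≤ W := Nat.pow_le_pow_right hN1 (by omega)
  obtain ⟨s₃, hE₃, hemb'⟩ := (hE₂.mono hW4).rename
    (f := fun x => if x = 1 then 1 else x + 2) (g := fun x => x + (12 + k))
    (fun x y hxy => by
      simp only at hxy
      split_ifs at hxy <;> omega)
    (fun x y hxy => Nat.add_right_cancel hxy) rfl hemb
  have hreg : s₃.reg (12 + k) = s₂.reg 0 := by simpa using hemb'.reg 0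
  have hW5 : 1 < W := by omega
  refine ⟨_, _, .seq hE₁ (.seq hE₃ (.seq (.const 5 1 _ hW5) (.op _ _ _ _ _ ?_))), ?_, ?_⟩
  · simp only [BinOp.apply]
    split_ifs <;> omega
  · have hvars : (PES F e (k * a * (q - 1))).numVars E = (φ.n / b + 1) * a := hEn
    have hb' := rpow_blocks_le (n := φ.n) hη hη1 hηδ hq hqb' hb
    rw [← hvars] at hb'
    exact running_time_le hη1 hN1 φ.size_le (hpoly _) (ht₁.trans (Nat.mul_le_mul_left _ (by omega)))
      ((Nat.le_succ _).trans hEsize) ht₂ hb'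
  · have h1 : ((PES F e (k * a * (q - 1))).Yes E) ↔ (kSAT k).Yes φ := hEquiv
    rw [← h1, ← hYes]
    simp [BinOp.apply, hreg, show 12 + k ≠ 5 by omega]

theorem theorem2 (hSETH : SETH) (q : ℕ) (hq : IsPrimePow q) (δ : ℚ) (hδ : 0 < δ) :
    ∃ d : ℕ, 0 < d ∧ ∀ (F : Type) [Field F] (e : F ≃ Fin q),
      ¬ (PES F e d).SolvableInOStar fun n => (q : ℝ) ^ ((1 - (δ : ℝ)) * (n : ℝ)) := by
  have hq2 : 2 ≤ q := hq.two_le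
  have hδ' : (0 : ℝ) < δ := by exact_mod_cast hδ
  -- Truncation at `1` keeps `1 - η` nonnegative, as needed to replace `q ^ a` by the larger base `2
  -- ^ (b + 1)`.
  set η : ℝ := min δ 1 with hη
  have hη0 : 0 < η := lt_min hδ' one_pos
  obtain ⟨k, hk, hSAT⟩ := hSETH (η / 4) (by linarith)
  -- As `q ≥ 2`, a block of `a` field elements holds `b ≥ a ≥ 2 / η` bits.
  set a := ⌈2 / η⌉₊ with ha
  have ha0 : 0 < a := Nat.ceil_pos.2 (by positivity)
  set b := Nat.log 2 (q ^ a) with hb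
  have hqa : q ^ a ≠ 0 := pow_ne_zero _ (by omega)
  have hab : a ≤ b := Nat.le_log_of_pow_le one_lt_two (Nat.pow_le_pow_left hq2 a)
  have hbη : 2 ≤ η * b := by
    have h1 : 2 / η ≤ b := (Nat.le_ceil _).trans (by exact_mod_cast hab)
    rwa [div_le_iff₀' hη0] at h1
  refine ⟨k * a * (q - 1), ?_, fun F _ e h => hSAT ?_⟩
  · have : 0 < k := by omega
    have : 0 < q - 1 := by omega
    positivity
  · exact kSAT_solvableInBigO e hη0 (min_le_right _ _) (min_le_left _ _) hq2 ha0
      (Nat.pow_log_le_self 2 hqa) (Nat.lt_pow_succ_log_self one_lt_two _) hbη h
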